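/- **Setting.** Let $d,n\ge 1$, $\lambda^0\in\mathbb R^d$, and for every $\lambda\in\mathbb R^d$ let $Z(\lambda)$ be a random vector of $\mathbb R^n$ with Lebesgue density $f(\lambda,\cdot)\ge 0$; write $Z^0=Z(\lambda^0)$. Let $\phi:\mathbb R^n\to\mathbb R$ be in $L^\infty$, put $V^\phi(\lambda)=E[\phi(Z(\lambda))]$ and $\beta=\nabla V^\phi(\lambda^0)$. Let $\ell$ be a probability density on $\mathbb R^d$ with $\ell(0)>0$, and let $(\Lambda_i,Z_i)_{i\ge1}$ be i.i.d. with density $\ell(\lambda^0-\lambda)f(\lambda,z)$ on $\mathbb R^d\times\mathbb R^n$. For a kernel $K:\mathbb R^d\to\mathbb R$ and a bandwidth $h=h_N>0$ let $$\hat\beta_N=\frac1{\ell(0)Nh^{d+1}}\sum_{i=1}^N\phi(Z_i)\Big(\nabla K\big(\tfrac{\lambda^0-\Lambda_i}h\big)+hK\big(\tfrac{\lambda^0-\Lambda_i}h\big)\frac{\nabla\ell}{\ell}(\lambda^0-\Lambda_i)\Big).$$ **Assumption K.** $K$ is $C^1$, compactly supported, $\int K=1$, and $K$ is of order $p\ge2$: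 $\int l_{\alpha_1}\cdots l_{\alpha_r}K(l)\,dl=0$ for all $0<r<p$ and all indices $\alpha_k\in\{1,\dots,d\}$, while $\int l_{j_1}\cdots l_{j_p}K(l)\,dl\ne0$ for some $j_1,\dots,j_p$. **Assumption R1.** $\ell$ and, for every $z$, $f(\cdot,z)$ are $p+1$ times differentiable on $\mathbb R^d$; and with $g(\lambda,z)=\ell(\lambda^0-\lambda)\nabla_\lambda f(\lambda,z)$ there is a set $S\subset\mathbb R^n$ with $\mathrm{Supp}(\phi)\subset\mathrm{int}(S)$ such that for every $i\le p$ the function $\lambda\mapsto\nabla^i_\lambda g(\lambda,z)$ is continuous at $\lambda^0$ uniformly in $z\in S$. **Theorem 4.1.** Assume K and R1, and let $h\to0$ and $Nh^{d+2}\to\infty$ as $N\to\infty$. Put $$\Sigma=\frac{E[\phi^2(Z^0)]}{\ell(0)}\int_{\mathbb R^d}\nabla K(l)\,\nabla K(l)'\,dl .$$ (i) Each $\hat\beta_N$ is integrable and $\sqrt{Nh^{d+2}}\,(\hat\beta_N-E[\hat\beta_N])\to\mathcal N(0,\Sigma)$ in distribution. (ii) Assume in addition that $Nh^{d+2+2p}\to0$,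 and that for some Lebesgue integrable $G$ and some $\delta>0$, $$|\phi(z)|\,\|\nabla^i_\lambda g(\lambda,z)-\nabla^i_\lambda g(\lambda^0,z)\|\le G(z)\qquad\text{for all } i\le p,\ |\lambda-\lambda^0|<\delta,\ z\in\mathbb R^n$$ (under R1 this holds automatically, with $G=|\phi|$, if $\phi$ is Lebesgue integrable, for instance if $\phi$ has bounded support). Then $V^\phi$ is differentiable at $\lambda^0$; the bias vanishes, that is, $E[\hat\beta_N]-\beta\to0$ and $\sqrt{Nh^{d+2}}\,(E[\hat\beta_N]-\beta)\to0$; and $\sqrt{Nh^{d+2}}\,(\hat\beta_N-\beta)\to\mathcal N(0,\Sigma)$ in distribution. -/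

import Mathlib

open MeasureTheory ProbabilityTheory Filter Topology

noncomputable section

namespace KernelGreeks

/-- `u` is `k` times (Fréchet) differentiable on the whole space: the iterated derivatives of
orders `0, …, k - 1` are differentiable. The derivative of order `k` need not be continuous. -/
def DifferentiableTimes {d : ℕ} (k : ℕ) (u : EuclideanSpace ℝ (Fin d) → ℝ) : Prop :=
  ∀ m < k, Differentiable ℝ (iteratedFDeriv ℝ m u)

/-- The moment `∫ l_{j_1} ⋯ l_{j_r} K(l) dl` of a kernel. -/
def kernelMoment {d : ℕ} (K : EuclideanSpace ℝ (Fin d) → ℝ) {r : ℕ} (j : Fin r → Fin d) : ℝ :=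
  ∫ l, (∏ k, l (j k)) * K l

/-- `K` is of order `p`: `p` is the smallest nonzero integer for which some moment of degree `p`
does not vanish. -/
def HasKernelOrder {d : ℕ} (K : EuclideanSpace ℝ (Fin d) → ℝ) (p : ℕ) : Prop :=
  0 < p ∧ (∀ r, 0 < r → r < p → ∀ α : Fin r → Fin d, kernelMoment K α = 0) ∧
    ∃ j : Fin p → Fin d, kernelMoment K j ≠ 0

/-- The assumption on the kernel: `C^1`, compactly supported, of integral one and of order
`p ≥ 2`. -/
structure AssumptionK {d : ℕ} (K : EuclideanSpace ℝ (Fin d) → ℝ) (p : ℕ) : Prop where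
  contDiff : ContDiff ℝ 1 K
  compact : HasCompactSupport K
  integral_eq_one : ∫ l, K l = 1
  two_le : 2 ≤ p
  order : HasKernelOrder K p

/-- The function `x ↦ ℓ(x₀ - x) ∇ₓ f(x, z)`. -/
def weightedGradient {d n : ℕ} (x₀ : EuclideanSpace ℝ (Fin d)) (ℓ : EuclideanSpace ℝ (Fin d) → ℝ)
    (f : EuclideanSpace ℝ (Fin d) → EuclideanSpace ℝ (Fin n) → ℝ) (z : EuclideanSpace ℝ (Fin n))
    (x : EuclideanSpace ℝ (Fin d)) : EuclideanSpace ℝ (Fin d) :=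
  ℓ (x₀ - x) • gradient (fun y => f y z) x

/-- The regularity assumption on the densities: `f(·, z)` and `ℓ` are `p + 1` times differentiable,
and the derivatives of orders `i ≤ p` of `x ↦ ℓ(x₀ - x) ∇ₓ f(x, z)` are continuous at `x₀`,
uniformly in `z ∈ S`, for some set `S` whose interior contains the support of `φ`. -/
structure AssumptionR1 {d n : ℕ} (p : ℕ) (x₀ : EuclideanSpace ℝ (Fin d))
    (ℓ : EuclideanSpace ℝ (Fin d) → ℝ)
    (f : EuclideanSpace ℝ (Fin d) → EuclideanSpace ℝ (Fin n) → ℝ)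
    (φ : EuclideanSpace ℝ (Fin n) → ℝ) : Prop where
  differentiable_f : ∀ z, DifferentiableTimes (p + 1) (fun x => f x z)
  differentiable_ℓ : DifferentiableTimes (p + 1) ℓ
  uniform_continuity : ∃ S : Set (EuclideanSpace ℝ (Fin n)), tsupport φ ⊆ interior S ∧
    ∀ i ≤ p, ∀ ε > 0, ∃ δ > 0, ∀ x ∈ Metric.ball x₀ δ, ∀ z ∈ S,
      ‖iteratedFDeriv ℝ i (weightedGradient x₀ ℓ f z) x -
        iteratedFDeriv ℝ i (weightedGradient x₀ ℓ f z) x₀‖ ≤ ε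

/-- The oscillation near `x₀` of the derivatives of orders `i ≤ p` of `x ↦ ℓ(x₀ - x) ∇ₓ f(x, z)`,
multiplied by `|φ(z)|`, is dominated by a Lebesgue integrable function of `z`. Under the
regularity assumption above this is automatic when `φ` is Lebesgue integrable. -/
def DominatedOscillation {d n : ℕ} (p : ℕ) (x₀ : EuclideanSpace ℝ (Fin d))
    (ℓ : EuclideanSpace ℝ (Fin d) → ℝ)
    (f : EuclideanSpace ℝ (Fin d) → EuclideanSpace ℝ (Fin n) → ℝ)
    (φ : EuclideanSpace ℝ (Fin n) → ℝ) : Prop :=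
  ∃ G : EuclideanSpace ℝ (Fin n) → ℝ, Integrable G ∧
    ∃ δ > 0, ∀ i ≤ p, ∀ x ∈ Metric.ball x₀ δ, ∀ z,
      |φ z| * ‖iteratedFDeriv ℝ i (weightedGradient x₀ ℓ f z) x -
        iteratedFDeriv ℝ i (weightedGradient x₀ ℓ f z) x₀‖ ≤ G z

/-- The joint law of `(Λ, Z)`, with density `(x, z) ↦ ℓ(x₀ - x) f(x, z)`. -/
def randomizedLaw {d n : ℕ} (x₀ : EuclideanSpace ℝ (Fin d)) (ℓ : EuclideanSpace ℝ (Fin d) → ℝ)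
    (f : EuclideanSpace ℝ (Fin d) → EuclideanSpace ℝ (Fin n) → ℝ) :
    Measure (EuclideanSpace ℝ (Fin d) × EuclideanSpace ℝ (Fin n)) :=
  volume.withDensity fun q => ENNReal.ofReal (ℓ (x₀ - q.1) * f q.1 q.2)

/-- The single-kernel estimator `β̂_N` with bandwidth `h`, computed from the first `N` terms of
the sample `(x i, z i)`:
`(ℓ(0) N h^{d+1})⁻¹ ∑_{i<N} φ(z_i) (∇K((x₀-x_i)/h) + h K((x₀-x_i)/h) (∇ℓ/ℓ)(x₀-x_i))`. -/
def betaHat {d n : ℕ} (K ℓ : EuclideanSpace ℝ (Fin d) → ℝ) (φ : EuclideanSpace ℝ (Fin n) → ℝ)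
    (x₀ : EuclideanSpace ℝ (Fin d)) (N : ℕ) (h : ℝ)
    (x : ℕ → EuclideanSpace ℝ (Fin d)) (z : ℕ → EuclideanSpace ℝ (Fin n)) :
    EuclideanSpace ℝ (Fin d) :=
  (1 / (ℓ 0 * N * h ^ (d + 1))) • ∑ i ∈ Finset.range N,
    φ (z i) • (gradient K (h⁻¹ • (x₀ - x i)) +
      (h * K (h⁻¹ • (x₀ - x i))) • ((ℓ (x₀ - x i))⁻¹ • gradient ℓ (x₀ - x i)))

/-- The asymptotic covariance `Σ = (m / ℓ(0)) ∫ ∇K ∇Kᵀ`, where `m` stands for `E[φ²(Z⁰)]`. -/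
def asymptoticCov {d : ℕ} (K ℓ : EuclideanSpace ℝ (Fin d) → ℝ) (m : ℝ) :
    Matrix (Fin d) (Fin d) ℝ :=
  (m / ℓ 0) • Matrix.of fun i j => ∫ l, gradient K l i * gradient K l j

end KernelGreeks

end

/-!
A sample point contributes `φ(z) s_h((x₀ - x) / h)` to the estimator, where `s_h → ∇K` as `h → 0`.
By Scheffé's lemma `x ↦ ∫ f(x, z) φ(z) ^ k dz` is continuous, so the moments of order one and two of
a contribution, divided by `h ^ d`, converge after rescaling; as `∫ ∇K = 0`, only the second one
survives, and it is `ℓ(0)² Σ`. The contributions being uniformly bounded while `N h ^ (d + 2) → ∞`,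
the second order expansion of the characteristic function gives the central limit theorem.

For the bias, an integration by parts moves the gradient from `K` to the density: the mean of the
estimator is `ℓ(0)⁻¹ ∫ φ(z) ∫ K(l) w(x₀ - h l, z) dl dz` with `w(x, z) = ℓ(x₀ - x) ∇ₓ f(x, z)`, the
derivative of `ℓ` being cancelled by the correction term `∇ℓ / ℓ`. Since the moments of `K` of
degrees `1, …, p - 1` vanish, Taylor's formula leaves a remainder of order `h ^ p`. Only the
oscillation of the derivatives of `w` is dominated, but a difference quotient bounds a derivative
by its oscillation and by increments of the preceding one. This controls the derivative of order
`p` in the remainder, and `∇ₓ f` itself when `∫ f(x, z) φ(z) dz` is differentiated.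
-/

noncomputable section

namespace KernelGreeks

open scoped InnerProductSpace Matrix

section CentralLimit

lemma norm_cexp_mul_I_sub_le {x : ℝ} (hx : |x| ≤ 1) :
    ‖Complex.exp (x * Complex.I) - (1 + x * Complex.I - (x ^ 2 : ℝ) / 2)‖ ≤ 3 * |x| * x ^ 2 := by
  have h := Complex.norm_exp_sub_sum_le_norm_mul_exp (x * Complex.I) 3
  have hsum : ∑ m ∈ Finset.range 3, ((x : ℂ) * Complex.I) ^ m / (m.factorial : ℂ)
      = 1 + x * Complex.I - (x ^ 2 : ℝ) / 2 := by
    simp [Finset.sum_range_succ, mul_pow]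
    ring
  rw [hsum, show ‖(x : ℂ) * Complex.I‖ = |x| by simp] at h
  calc _ ≤ |x| ^ 3 * Real.exp |x| := h
    _ ≤ |x| ^ 3 * 3 := by
        gcongr
        exact (Real.exp_le_exp.2 hx).trans Real.exp_one_lt_three.le
    _ = 3 * |x| * x ^ 2 := by rw [← sq_abs x]; ring

section CharFun

variable {E : Type*} [NormedAddCommGroup E] [InnerProductSpace ℝ E] [MeasurableSpace E]
  [BorelSpace E] [SecondCountableTopology E] [CompleteSpace E]

lemma norm_charFun_sub_le {μ : Measure E} [IsProbabilityMeasure μ] (h0 : ∫ x, x ∂μ = 0) {ε : ℝ}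
    (hb : ∀ᵐ x ∂μ, ‖x‖ ≤ ε) {t : E} (ht : ε * ‖t‖ ≤ 1) :
    ‖charFun μ t - (1 - (∫ x, ⟪x, t⟫_ℝ ^ 2 ∂μ : ℝ) / 2)‖
      ≤ 3 * (ε * ‖t‖) * ∫ x, ⟪x, t⟫_ℝ ^ 2 ∂μ := by
  have hbt : ∀ᵐ x ∂μ, |⟪x, t⟫_ℝ| ≤ ε * ‖t‖ := by
    filter_upwards [hb] with x hx
    exact (abs_real_inner_le_norm _ _).trans (by gcongr)
  have hi1 : Integrable (fun x => ⟪x, t⟫_ℝ) μ :=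
    .of_bound (by fun_prop) (ε * ‖t‖) hbt
  have hi2 : Integrable (fun x => ⟪x, t⟫_ℝ ^ 2) μ := by
    refine .of_bound (by fun_prop) ((ε * ‖t‖) ^ 2) ?_
    filter_upwards [hbt] with x hx
    rw [norm_pow]
    exact pow_le_pow_left₀ (norm_nonneg _) hx 2
  have hmean : ∫ x, ⟪x, t⟫_ℝ ∂μ = 0 := by
    simp only [real_inner_comm t]
    rw [integral_inner (.of_bound (by fun_prop) ε hb), h0, inner_zero_right]
  have hexp : Integrable (fun x => Complex.exp (⟪x, t⟫_ℝ * Complex.I)) μ :=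
    .of_bound (by fun_prop) 1 (ae_of_all _ fun x => (Complex.norm_exp_ofReal_mul_I _).le)
  have hlin : Integrable (fun x => (1 : ℂ) + ⟪x, t⟫_ℝ * Complex.I) μ :=
    (integrable_const _).add (hi1.ofReal.mul_const _)
  have hsq : Integrable (fun x => ((⟪x, t⟫_ℝ ^ 2 : ℝ) : ℂ) / 2) μ := hi2.ofReal.div_const _
  have hquad : Integrable (fun x => (1 : ℂ) + ⟪x, t⟫_ℝ * Complex.I -
      ((⟪x, t⟫_ℝ ^ 2 : ℝ) : ℂ) / 2) μ := hlin.sub hsq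
  have hpoly : ∫ x, ((1 : ℂ) + ⟪x, t⟫_ℝ * Complex.I - ((⟪x, t⟫_ℝ ^ 2 : ℝ) : ℂ) / 2) ∂μ
      = 1 - (∫ x, ⟪x, t⟫_ℝ ^ 2 ∂μ : ℝ) / 2 := by
    rw [integral_sub hlin hsq, integral_add (integrable_const _) (hi1.ofReal.mul_const _),
      integral_mul_const, integral_div, integral_complex_ofReal, integral_complex_ofReal, hmean]
    simp
  rw [charFun_apply, ← hpoly, ← integral_sub hexp hquad, ← integral_const_mul]
  refine norm_integral_le_of_norm_le (hi2.const_mul _) ?_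
  filter_upwards [hbt] with x hx
  exact (norm_cexp_mul_I_sub_le (hx.trans ht)).trans (by gcongr)

lemma tendsto_charFun_pow {μ : ℕ → Measure E} [∀ N, IsProbabilityMeasure (μ N)]
    (h0 : ∀ᶠ N in atTop, ∫ x, x ∂μ N = 0) {ε : ℕ → ℝ} (hε : Tendsto ε atTop (𝓝 0))
    (hb : ∀ᶠ N in atTop, ∀ᵐ x ∂μ N, ‖x‖ ≤ ε N) {t : E} {s : ℝ}
    (hv : Tendsto (fun N : ℕ => N * ∫ x, ⟪x, t⟫_ℝ ^ 2 ∂μ N) atTop (𝓝 s)) :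
    Tendsto (fun N => charFun (μ N) t ^ N) atTop (𝓝 (Complex.exp (-(s / 2 : ℂ)))) := by
  set v : ℕ → ℝ := fun N => ∫ x, ⟪x, t⟫_ℝ ^ 2 ∂μ N
  have hεt : Tendsto (fun N => ε N * ‖t‖) atTop (𝓝 0) := by simpa using hε.mul_const ‖t‖
  have hmain : Tendsto (fun N : ℕ => -(((N * v N : ℝ) : ℂ) / 2)) atTop (𝓝 (-(s / 2 : ℂ))) :=
    (((Complex.continuous_ofReal.tendsto _).comp hv).div_const _).neg
  have hrem : Tendsto (fun N : ℕ => (N : ℂ) * (charFun (μ N) t - (1 - (v N : ℂ) / 2))) atTop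
      (𝓝 0) := by
    have hbound : Tendsto (fun N : ℕ => 3 * (ε N * ‖t‖) * (N * v N)) atTop (𝓝 0) := by
      simpa using (hεt.const_mul 3).mul hv
    refine squeeze_zero_norm' ?_ hbound
    filter_upwards [h0, hb, hεt.eventually_le_const one_pos] with N hN0 hNb hNt
    rw [norm_mul, Complex.norm_natCast]
    calc (N : ℝ) * _ ≤ N * (3 * (ε N * ‖t‖) * v N) := by
          gcongr
          exact norm_charFun_sub_le hN0 hNb hNt
      _ = _ := by ring
  have h1 : Tendsto (fun N : ℕ => (1 + (charFun (μ N) t - 1)) ^ N) atTop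
      (𝓝 (Complex.exp (-(s / 2 : ℂ)))) := by
    refine Complex.tendsto_one_add_pow_exp_of_tendsto ?_
    have hsum := hmain.add hrem
    rw [add_zero] at hsum
    refine hsum.congr fun N => ?_
    push_cast
    ring
  simpa using h1

end CharFun

variable {ι : Type*} [Fintype ι] [DecidableEq ι] {Ω : Type*} [MeasurableSpace Ω] {P : Measure Ω}
  [IsProbabilityMeasure P] {S : Matrix ι ι ℝ}

theorem tendstoInDistribution_sum_of_small {X : ℕ → ℕ → Ω → EuclideanSpace ℝ ι}
    {μ : ℕ → Measure (EuclideanSpace ℝ ι)} (hX : ∀ N i, HasLaw (X N i) (μ N) P)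
    (hindep : ∀ N, iIndepFun (X N) P) (h0 : ∀ᶠ N in atTop, ∫ x, x ∂μ N = 0) {ε : ℕ → ℝ}
    (hε : Tendsto ε atTop (𝓝 0)) (hb : ∀ᶠ N in atTop, ∀ᵐ x ∂μ N, ‖x‖ ≤ ε N) (hS : S.PosSemidef)
    (hv : ∀ t, Tendsto (fun N : ℕ => N * ∫ x, ⟪x, t⟫_ℝ ^ 2 ∂μ N) atTop (𝓝 (t ⬝ᵥ S *ᵥ t))) :
    TendstoInDistribution (fun N ω => ∑ i ∈ Finset.range N, X N i ω) atTop id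
      (fun _ => P) (multivariateGaussian 0 S) where
  forall_aemeasurable N := Finset.aemeasurable_fun_sum _ fun i _ => (hX N i).aemeasurable
  tendsto := by
    have _ (N) : IsProbabilityMeasure (μ N) := (hX N 0).isProbabilityMeasure_iff.1 inferInstance
    refine ProbabilityMeasure.tendsto_iff_tendsto_charFun.2 fun t => ?_
    have hcf (N : ℕ) : charFun (P.map fun ω => ∑ i ∈ Finset.range N, X N i ω) t
        = charFun (μ N) t ^ N := by
      rw [((hindep N).restrict _).charFun_map_fun_finsetSum_eq_prod fun i _ =>
        (hX N i).aemeasurable]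
      simp [(hX N _).map_eq]
    simp only [ProbabilityMeasure.coe_mk, Measure.map_id, hcf, charFun_multivariateGaussian hS]
    simpa using tendsto_charFun_pow h0 hε hb (hv t)

theorem tendstoInDistribution_smul_sum_sub_integral {𝓧 : Type*} [MeasurableSpace 𝓧]
    {μ : Measure 𝓧} {W : ℕ → Ω → 𝓧} (hW : ∀ i, HasLaw (W i) μ P) (hindep : iIndepFun W P)
    {Y : ℕ → 𝓧 → EuclideanSpace ℝ ι} (hY : ∀ N, AEMeasurable (Y N) μ) {B : ℝ}
    (hB : ∀ᶠ N in atTop, ∀ᵐ q ∂μ, ‖Y N q‖ ≤ B) {a : ℕ → ℝ} (ha : Tendsto a atTop (𝓝 0))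
    (hS : S.PosSemidef)
    (hv : ∀ t, Tendsto (fun N : ℕ => N * a N ^ 2 * Var[fun q => ⟪Y N q, t⟫_ℝ; μ]) atTop
      (𝓝 (t ⬝ᵥ S *ᵥ t))) :
    TendstoInDistribution
      (fun N ω => a N • ∑ i ∈ Finset.range N, (Y N (W i ω) - ∫ q, Y N q ∂μ)) atTop id
      (fun _ => P) (multivariateGaussian 0 S) := by
  have _ : IsProbabilityMeasure μ := (hW 0).isProbabilityMeasure_iff.1 inferInstance
  set X : ℕ → 𝓧 → EuclideanSpace ℝ ι := fun N q => a N • (Y N q - ∫ q', Y N q' ∂μ) with hXdef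
  have hX (N) : AEMeasurable (X N) μ := ((hY N).sub_const _).const_smul (a N)
  have hlaw (N) : HasLaw (X N) (μ.map (X N)) μ := ⟨hX N, rfl⟩
  have hint : ∀ᶠ N in atTop, Integrable (Y N) μ := hB.mono fun N hN =>
    .of_bound (hY N).aestronglyMeasurable B hN
  simp only [Finset.smul_sum]
  refine tendstoInDistribution_sum_of_small (μ := fun N => μ.map (X N))
    (ε := fun N => |a N| * (2 * B)) (fun N i => (hlaw N).comp (hW i)) (fun N => ?_) ?_ ?_ ?_
    hS fun t => (hv t).congr' ?_
  · exact hindep.comp₀ (fun _ => X N) (fun i => (hW i).aemeasurable)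
      fun i => by rw [(hW i).map_eq]; exact hX N
  · filter_upwards [hint] with N hN
    rw [integral_map (hX N) (by fun_prop)]
    simp [hXdef, integral_smul, integral_sub hN]
  · simpa using ha.abs.mul_const (2 * B)
  · filter_upwards [hB] with N hN
    rw [ae_map_iff (hX N) (measurableSet_le (by fun_prop) (by fun_prop))]
    filter_upwards [hN] with q hq
    have hmean : ‖∫ q', Y N q' ∂μ‖ ≤ B := by
      simpa using norm_integral_le_of_norm_le_const hN
    rw [hXdef, norm_smul, Real.norm_eq_abs]
    gcongr
    linarith [norm_sub_le (Y N q) (∫ q', Y N q' ∂μ)]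
  · filter_upwards [hint] with N hN
    rw [integral_map (hX N) (by fun_prop), variance_eq_integral ((hY N).inner_const), mul_assoc,
      ← integral_const_mul]
    congr 1
    refine integral_congr_ae (ae_of_all _ fun q => ?_)
    have hmean : ∫ q', ⟪Y N q', t⟫_ℝ ∂μ = ⟪∫ q', Y N q' ∂μ, t⟫_ℝ := by
      simp only [real_inner_comm t]
      exact integral_inner hN t
    simp only [hXdef, hmean, real_inner_smul_left, inner_sub_left]
    ring

end CentralLimit

section Taylor

universe u

/-- Differentiability to order `k`: the iterated derivatives of orders `0, …, k - 1` are
differentiable. The derivative of order `k` need not be continuous, so this is weaker than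
`ContDiff ℝ k`. For real functions on a Euclidean space it is `DifferentiableTimes`. -/
def IterDifferentiable {E F : Type*} [NormedAddCommGroup E] [NormedSpace ℝ E]
    [NormedAddCommGroup F] [NormedSpace ℝ F] (k : ℕ) (u : E → F) : Prop :=
  ∀ m < k, Differentiable ℝ (iteratedFDeriv ℝ m u)

namespace IterDifferentiable

-- One universe for all spaces, since the inductions replace `F` by `E →L[ℝ] F`.
variable {E F G W : Type u} [NormedAddCommGroup E] [NormedSpace ℝ E] [NormedAddCommGroup F]
  [NormedSpace ℝ F] [NormedAddCommGroup G] [NormedSpace ℝ G] [NormedAddCommGroup W]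
  [NormedSpace ℝ W] {k : ℕ} {u : E → F}

protected lemma zero (u : E → F) : IterDifferentiable 0 u :=
  fun _ hm => absurd hm (Nat.not_lt_zero _)

lemma mono {j : ℕ} (hu : IterDifferentiable k u) (hj : j ≤ k) : IterDifferentiable j u :=
  fun m hm => hu m (hm.trans_le hj)

lemma contDiff (hu : IterDifferentiable (k + 1) u) : ContDiff ℝ k u :=
  contDiff_of_differentiable_iteratedFDeriv fun m hm => hu m (by
    have : m ≤ k := by exact_mod_cast hm
    omega)

lemma contDiff_one (hu : IterDifferentiable (k + 1) u) (hk : k ≠ 0) : ContDiff ℝ 1 u :=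
  hu.contDiff.of_le (by exact_mod_cast Nat.one_le_iff_ne_zero.2 hk)

lemma succ_iff :
    IterDifferentiable (k + 1) u ↔ Differentiable ℝ u ∧ IterDifferentiable k (fderiv ℝ u) := by
  have hzero : Differentiable ℝ (iteratedFDeriv ℝ 0 u) ↔ Differentiable ℝ u := by
    rw [iteratedFDeriv_zero_eq_comp]
    exact (continuousMultilinearCurryFin0 ℝ E F).symm.comp_differentiable_iff
  have hsucc (m : ℕ) : Differentiable ℝ (iteratedFDeriv ℝ (m + 1) u) ↔
      Differentiable ℝ (iteratedFDeriv ℝ m (fderiv ℝ u)) := by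
    rw [show iteratedFDeriv ℝ (m + 1) u = _ from
      funext fun x => iteratedFDeriv_succ_eq_comp_right (f := u) (x := x)]
    exact LinearIsometryEquiv.comp_differentiable_iff (𝕜 := ℝ) (G := E)
      (E := E [×m]→L[ℝ] E →L[ℝ] F) (F := E [×(m + 1)]→L[ℝ] F)
      (iso := (continuousMultilinearCurryRightEquiv' ℝ m E F).symm)
  constructor
  · intro h
    exact ⟨hzero.1 (h 0 k.succ_pos), fun m hm => (hsucc m).1 (h _ (Nat.succ_lt_succ hm))⟩
  · rintro ⟨h1, h2⟩ (_ | m) hm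
    · exact hzero.2 h1
    · exact (hsucc m).2 (h2 m (Nat.lt_of_succ_lt_succ hm))

protected lemma add {v : E → F} (hu : IterDifferentiable k u) (hv : IterDifferentiable k v) :
    IterDifferentiable k (fun x => u x + v x) := by
  induction k generalizing F with
  | zero => exact .zero _
  | succ k ih =>
    rw [succ_iff] at *
    refine ⟨hu.1.add hv.1, ?_⟩
    rw [show fderiv ℝ (fun x => u x + v x) = fun x => fderiv ℝ u x + fderiv ℝ v x from
      funext fun x => fderiv_fun_add (hu.1 x) (hv.1 x)]
    exact ih hu.2 hv.2

lemma clm_comp (hu : IterDifferentiable k u) (L : F →L[ℝ] G) :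
    IterDifferentiable k (fun x => L (u x)) := by
  induction k generalizing F G with
  | zero => exact .zero _
  | succ k ih =>
    rw [succ_iff] at *
    refine ⟨L.differentiable.comp hu.1, ?_⟩
    rw [show fderiv ℝ (fun x => L (u x)) =
        fun x => ContinuousLinearMap.compL ℝ E F G L (fderiv ℝ u x) from
      funext fun x => (L.hasFDerivAt.comp x (hu.1 x).hasFDerivAt).fderiv]
    exact ih hu.2 _

lemma bilinear {v : E → G} (hu : IterDifferentiable k u) (hv : IterDifferentiable k v)
    (B : F →L[ℝ] G →L[ℝ] W) : IterDifferentiable k (fun x => B (u x) (v x)) := by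
  induction k generalizing F G W with
  | zero => exact .zero _
  | succ k ih =>
    have hu' := hu.mono k.le_succ
    have hv' := hv.mono k.le_succ
    rw [succ_iff] at *
    have hd (x : E) := B.hasFDerivAt_of_bilinear (hu.1 x).hasFDerivAt (hv.1 x).hasFDerivAt
    refine ⟨fun x => (hd x).differentiableAt, ?_⟩
    rw [show fderiv ℝ (fun x => B (u x) (v x)) = _ from funext fun x => (hd x).fderiv]
    exact (ih hu' hv.2 (B.precompR E)).add (ih hu.2 hv' (B.precompL E))

lemma comp_const_sub (hu : IterDifferentiable k u) (a : E) :
    IterDifferentiable k (fun x => u (a - x)) := by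
  induction k generalizing F with
  | zero => exact .zero _
  | succ k ih =>
    rw [succ_iff] at *
    refine ⟨hu.1.comp ((differentiable_const a).sub differentiable_id), ?_⟩
    rw [show fderiv ℝ (fun x => u (a - x)) =
        fun x => (-ContinuousLinearMap.id ℝ (E →L[ℝ] F)) (fderiv ℝ u (a - x)) from
      funext fun x => (((hu.1 (a - x)).hasFDerivAt.comp x
        ((hasFDerivAt_id x).const_sub a)).congr_fderiv (by ext; simp)).fderiv]
    exact (ih hu.2).clm_comp _

lemma hasDerivAt_line (hu : IterDifferentiable k u) {i : ℕ} (hi : i < k) (x v : E) (t : ℝ) :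
    HasDerivAt (fun s : ℝ => iteratedFDeriv ℝ i u (x + s • v) (fun _ => v))
      (iteratedFDeriv ℝ (i + 1) u (x + t • v) (fun _ => v)) t := by
  have hline : HasDerivAt (fun s : ℝ => x + s • v) v t := by
    simpa using ((hasDerivAt_id t).smul_const v).const_add x
  rw [iteratedFDeriv_succ_apply_left]
  exact (ContinuousMultilinearMap.apply ℝ (fun _ : Fin i => E) F
    (fun _ => v)).hasFDerivAt.comp_hasDerivAt t
      ((hu i hi (x + t • v)).hasFDerivAt.comp_hasDerivAt t hline)

end IterDifferentiable

lemma norm_sub_taylor_le_of_hasDerivAt {F : Type*} [NormedAddCommGroup F] [NormedSpace ℝ F] {k : ℕ}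
    {a : ℕ → ℝ → F} {b M : ℝ}
    (ha : ∀ i < k, ∀ t ∈ Set.Icc 0 b, HasDerivAt (a i) (a (i + 1) t) t)
    (hM : ∀ t ∈ Set.Icc 0 b, ‖a k t‖ ≤ M) {t : ℝ} (ht : t ∈ Set.Icc 0 b) :
    ‖a 0 t - ∑ i ∈ Finset.range k, (t ^ i / (i.factorial : ℝ)) • a i 0‖
      ≤ M * (t ^ k / k.factorial) := by
  induction k generalizing a t with
  | zero => simpa using hM t ht
  | succ k ih =>
    have hpow (i : ℕ) (s : ℝ) : HasDerivAt (fun s : ℝ => s ^ (i + 1) / ((i + 1).factorial : ℝ))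
        (s ^ i / (i.factorial : ℝ)) s := by
      refine ((hasDerivAt_pow (i + 1) s).div_const ((i + 1).factorial : ℝ)).congr_deriv ?_
      rw [Nat.factorial_succ, Nat.cast_mul, mul_div_mul_left _ _ (by positivity),
        add_tsub_cancel_right]
    have hrem : ∀ s ∈ Set.Icc 0 b, HasDerivAt
        (fun s => a 0 s - ∑ i ∈ Finset.range (k + 1), (s ^ i / (i.factorial : ℝ)) • a i 0)
        (a 1 s - ∑ i ∈ Finset.range k, (s ^ i / (i.factorial : ℝ)) • a (i + 1) 0) s := by
      intro s hs
      simp only [Finset.sum_range_succ', pow_zero]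
      refine (ha 0 k.succ_pos s hs).sub (.add_const _ (HasDerivAt.fun_sum fun i _ => ?_))
      exact (hpow i s).smul_const _
    refine image_norm_le_of_norm_deriv_right_le_deriv_boundary
      (fun s hs => (hrem s hs).continuousAt.continuousWithinAt)
      (fun s hs => (hrem s (Set.Ico_subset_Icc_self hs)).hasDerivWithinAt) ?_
      (fun s => (hpow k s).const_mul M) (fun s hs => ?_) ht
    · simp [Finset.sum_range_succ']
    · exact ih (a := fun i => a (i + 1)) (fun i hi => ha (i + 1) (by omega)) hM
        (Set.Ico_subset_Icc_self hs)

variable {E F : Type u} [NormedAddCommGroup E] [NormedSpace ℝ E] [NormedAddCommGroup F]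
  [NormedSpace ℝ F] {k : ℕ} {g : E → F}

lemma IterDifferentiable.norm_sub_taylor_le (hg : IterDifferentiable k g) {x v : E} {C : ℝ}
    (hC : ∀ t ∈ Set.Icc (0 : ℝ) 1, ‖iteratedFDeriv ℝ k g (x + t • v)‖ ≤ C) :
    ‖g (x + v) - ∑ i ∈ Finset.range k, (i.factorial : ℝ)⁻¹ • iteratedFDeriv ℝ i g x (fun _ => v)‖
      ≤ C * ‖v‖ ^ k / k.factorial := by
  have := norm_sub_taylor_le_of_hasDerivAt (k := k) (b := 1) (t := 1) (M := C * ‖v‖ ^ k)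
    (a := fun i s => iteratedFDeriv ℝ i g (x + s • v) (fun _ => v))
    (fun i hi t _ => hg.hasDerivAt_line hi x v t) (fun t ht => by
      refine (ContinuousMultilinearMap.le_opNorm _ _).trans ?_
      simp only [Finset.prod_const, Finset.card_univ, Fintype.card_fin]
      gcongr
      exact hC t ht) ⟨zero_le_one, le_rfl⟩
  simpa [div_eq_mul_inv] using this

lemma IterDifferentiable.norm_fderiv_iteratedFDeriv_le_of_oscillation
    (hg : IterDifferentiable (k + 1) g) {x : E} {δ C : ℝ} (hδ : 0 < δ)
    (h0 : ∀ y ∈ Metric.ball x δ, ‖iteratedFDeriv ℝ k g y - iteratedFDeriv ℝ k g x‖ ≤ C)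
    (h1 : ∀ y ∈ Metric.ball x δ, ‖fderiv ℝ (iteratedFDeriv ℝ k g) y -
      fderiv ℝ (iteratedFDeriv ℝ k g) x‖ ≤ C) :
    ‖fderiv ℝ (iteratedFDeriv ℝ k g) x‖ ≤ (1 + 2 * δ⁻¹) * C := by
  have hC : 0 ≤ C := (norm_nonneg _).trans (h0 x (Metric.mem_ball_self hδ))
  refine ContinuousLinearMap.opNorm_le_of_shell (c := (2 : ℝ)) hδ (by positivity) (by simp)
    fun v hv1 hv2 => ?_
  have hv : x + v ∈ Metric.ball x δ := by simpa using hv2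
  have hlin := (convex_ball x δ).norm_image_sub_le_of_norm_fderiv_le'
    (fun y _ => hg k k.lt_succ_self y) h1 (Metric.mem_ball_self hδ) hv
  rw [add_sub_cancel_left] at hlin
  have hscale : 1 ≤ 2 * δ⁻¹ * ‖v‖ := by
    rw [Real.norm_of_nonneg zero_le_two] at hv1
    calc 1 = 2 * δ⁻¹ * (δ / 2) := by field_simp
      _ ≤ _ := by gcongr
  calc _ ≤ ‖iteratedFDeriv ℝ k g (x + v) - iteratedFDeriv ℝ k g x‖ +
        ‖iteratedFDeriv ℝ k g (x + v) - iteratedFDeriv ℝ k g x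
          - fderiv ℝ (iteratedFDeriv ℝ k g) x v‖ := by
        rw [norm_sub_rev _ (fderiv ℝ (iteratedFDeriv ℝ k g) x v)]
        exact norm_le_insert' _ _
    _ ≤ C * (2 * δ⁻¹ * ‖v‖) + C * ‖v‖ :=
        add_le_add ((h0 _ hv).trans (le_mul_of_one_le_right hC hscale)) hlin
    _ = _ := by ring

/-- A derivative whose oscillation is at most `C` is determined up to a multiple of `C` by the
increments of the preceding one; if these are also at most `C`, it is itself of order `C`. -/
lemma IterDifferentiable.norm_iteratedFDeriv_succ_le_of_oscillation
    (hg : IterDifferentiable (k + 1) g) {x : E} {δ C : ℝ}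
    (h0 : ∀ y ∈ Metric.ball x δ, ‖iteratedFDeriv ℝ k g y - iteratedFDeriv ℝ k g x‖ ≤ C)
    (h1 : ∀ y ∈ Metric.ball x δ,
      ‖iteratedFDeriv ℝ (k + 1) g y - iteratedFDeriv ℝ (k + 1) g x‖ ≤ C)
    {y : E} (hy : y ∈ Metric.ball x δ) :
    ‖iteratedFDeriv ℝ (k + 1) g y‖ ≤ 2 * (1 + δ⁻¹) * C := by
  have h1' : ∀ y ∈ Metric.ball x δ, ‖fderiv ℝ (iteratedFDeriv ℝ k g) y -
      fderiv ℝ (iteratedFDeriv ℝ k g) x‖ ≤ C := by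
    intro y hy
    have := h1 y hy
    rwa [iteratedFDeriv_succ_eq_comp_left, Function.comp_apply, Function.comp_apply,
      ← dist_eq_norm, LinearIsometryEquiv.dist_map, dist_eq_norm] at this
  have hx := hg.norm_fderiv_iteratedFDeriv_le_of_oscillation (Metric.pos_of_mem_ball hy) h0 h1'
  rw [← norm_fderiv_iteratedFDeriv]
  linarith [norm_le_insert' (fderiv ℝ (iteratedFDeriv ℝ k g) y)
    (fderiv ℝ (iteratedFDeriv ℝ k g) x), h1' y hy]

end Taylor

section SmoothingBias

variable {d : ℕ} {K : EuclideanSpace ℝ (Fin d) → ℝ} {F : Type*} [NormedAddCommGroup F]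
  [NormedSpace ℝ F] [CompleteSpace F]

lemma integral_smul_multilinear_eq_zero (hK : Continuous K) (hKc : HasCompactSupport K) {r : ℕ}
    (hmom : ∀ α : Fin r → Fin d, kernelMoment K α = 0)
    (m : ContinuousMultilinearMap ℝ (fun _ : Fin r => EuclideanSpace ℝ (Fin d)) F) :
    ∫ l, K l • m (fun _ => l) = 0 := by
  set e : Fin d → EuclideanSpace ℝ (Fin d) := fun i => EuclideanSpace.single i 1
  have hexp (l : EuclideanSpace ℝ (Fin d)) : K l • m (fun _ => l) =
      ∑ j : Fin r → Fin d, ((∏ k, l (j k)) * K l) • m (fun k => e (j k)) := by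
    have hl : l = ∑ i, l i • e i := by
      ext i
      simp [e, Pi.single_apply]
    have hm : m (fun _ => l) = ∑ j : Fin r → Fin d, m (fun k => l (j k) • e (j k)) := by
      conv_lhs => rw [hl]
      exact m.toMultilinearMap.map_sum (fun _ i => l i • e i)
    rw [hm, Finset.smul_sum]
    refine Finset.sum_congr rfl fun j _ => ?_
    rw [m.map_smul_univ, smul_smul, mul_comm]
  have hint (j : Fin r → Fin d) :
      Integrable (fun l : EuclideanSpace ℝ (Fin d) => (∏ k, l (j k)) * K l) :=
    Continuous.integrable_of_hasCompactSupport (by fun_prop) hKc.mul_left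
  simp_rw [hexp]
  rw [integral_finsetSum _ fun j _ => (hint j).smul_const _]
  refine Finset.sum_eq_zero fun j _ => ?_
  rw [integral_smul_const, ← kernelMoment, hmom j, zero_smul]

lemma integral_smul_taylor_eq (hK : Continuous K) (hKc : HasCompactSupport K)
    (hK1 : ∫ l, K l = 1) {p : ℕ} (hp : p ≠ 0)
    (hmom : ∀ r, 0 < r → r < p → ∀ α : Fin r → Fin d, kernelMoment K α = 0)
    (g : EuclideanSpace ℝ (Fin d) → F) (x : EuclideanSpace ℝ (Fin d)) (c : ℝ) :
    ∫ l, K l • ∑ i ∈ Finset.range p,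
      (i.factorial : ℝ)⁻¹ • iteratedFDeriv ℝ i g x (fun _ => c • l) = g x := by
  have hterm (i : ℕ) (l : EuclideanSpace ℝ (Fin d)) :
      K l • (i.factorial : ℝ)⁻¹ • iteratedFDeriv ℝ i g x (fun _ => c • l) =
        ((i.factorial : ℝ)⁻¹ * c ^ i) • (K l • iteratedFDeriv ℝ i g x (fun _ => l)) := by
    rw [(iteratedFDeriv ℝ i g x).map_smul_univ (fun _ => c) (fun _ => l), smul_comm (K l),
      smul_comm (K l), smul_smul, Fin.prod_const]
  have hint (i : ℕ) : Integrable fun l => ((i.factorial : ℝ)⁻¹ * c ^ i) •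
      (K l • iteratedFDeriv ℝ i g x (fun _ => l)) :=
    ((hK.smul ((iteratedFDeriv ℝ i g x).cont.comp
      (by fun_prop))).integrable_of_hasCompactSupport hKc.smul_right).smul _
  obtain ⟨q, rfl⟩ := Nat.exists_eq_succ_of_ne_zero hp
  simp_rw [Finset.smul_sum, hterm]
  rw [integral_finsetSum _ fun i _ => hint i, Finset.sum_range_succ', Finset.sum_eq_zero, zero_add]
  · simp [integral_smul_const, hK1]
  · intro i hi
    rw [integral_smul, integral_smul_multilinear_eq_zero hK hKc
      (hmom _ i.succ_pos (by have := Finset.mem_range.1 hi; omega)), smul_zero]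

lemma norm_integral_smul_sub_le {F : Type} [NormedAddCommGroup F] [NormedSpace ℝ F]
    [CompleteSpace F] (hK : Continuous K) (hKc : HasCompactSupport K) (hK1 : ∫ l, K l = 1)
    {p : ℕ} (hp : p ≠ 0)
    (hmom : ∀ r, 0 < r → r < p → ∀ α : Fin r → Fin d, kernelMoment K α = 0) {R : ℝ}
    (hR : ∀ l, K l ≠ 0 → ‖l‖ ≤ R) {g : EuclideanSpace ℝ (Fin d) → F}
    (hg : IterDifferentiable p g) {x : EuclideanSpace ℝ (Fin d)} {δ C h : ℝ} (hh : 0 ≤ h)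
    (hhR : h * R < δ) (hC : ∀ y ∈ Metric.ball x δ, ‖iteratedFDeriv ℝ p g y‖ ≤ C) :
    ‖(∫ l, K l • g (x - h • l)) - g x‖ ≤ (∫ l, |K l|) * (C * (h * R) ^ p / p.factorial) := by
  have hgc : Continuous g := by
    obtain ⟨q, rfl⟩ := Nat.exists_eq_succ_of_ne_zero hp
    exact (IterDifferentiable.succ_iff.1 hg).1.continuous
  have hint {u : EuclideanSpace ℝ (Fin d) → F} (hu : Continuous u) :
      Integrable (fun l => K l • u l) :=
    (hK.smul hu).integrable_of_hasCompactSupport hKc.smul_right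
  have hTaylor : Continuous fun l : EuclideanSpace ℝ (Fin d) => ∑ i ∈ Finset.range p,
      (i.factorial : ℝ)⁻¹ • iteratedFDeriv ℝ i g x (fun _ => -h • l) :=
    continuous_finsetSum _ fun i _ =>
      ((iteratedFDeriv ℝ i g x).cont.comp (by fun_prop)).const_smul _
  conv_lhs => rw [← integral_smul_taylor_eq hK hKc hK1 hp hmom g x (-h)]
  rw [← integral_sub (hint (by fun_prop)) (hint hTaylor), ← integral_mul_const]
  refine norm_integral_le_of_norm_le ((hK.abs.integrable_of_hasCompactSupport
    hKc.abs).mul_const _) (ae_of_all _ fun l => ?_)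
  rw [← smul_sub, norm_smul, Real.norm_eq_abs]
  by_cases hl : K l = 0
  · simp [hl]
  have hv : ‖-h • l‖ ≤ h * R := by
    rw [neg_smul, norm_neg, norm_smul, Real.norm_of_nonneg hh]
    gcongr
    exact hR l hl
  have hball : ∀ t ∈ Set.Icc (0 : ℝ) 1, ‖iteratedFDeriv ℝ p g (x + t • -h • l)‖ ≤ C := by
    intro t ht
    refine hC _ ?_
    rw [mem_ball_iff_norm, add_sub_cancel_left, norm_smul, Real.norm_of_nonneg ht.1]
    exact (mul_le_of_le_one_left (norm_nonneg _) ht.2).trans_lt (hv.trans_lt hhR)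
  have hC0 : 0 ≤ C := (norm_nonneg _).trans (hball 0 ⟨le_rfl, zero_le_one⟩)
  have hrem := hg.norm_sub_taylor_le hball
  rw [neg_smul, ← sub_eq_add_neg, ← neg_smul] at hrem
  gcongr
  exact hrem.trans (by gcongr)

end SmoothingBias

section EssentiallyBounded

variable {X S : Type*} [MeasurableSpace X] [MeasurableSpace S] {ρ : Measure X} {ν : Measure S}
  {φ : S → ℝ}

lemma memLp_top_pow (hφ : MemLp φ ⊤ ν) (k : ℕ) : MemLp (fun z => φ z ^ k) ⊤ ν := by
  refine memLp_top_of_bound (hφ.1.pow k) (lpNorm φ ⊤ ν ^ k) ?_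
  filter_upwards [ae_le_lpNorm_exponent_top hφ] with z hz
  rw [norm_pow]
  gcongr

lemma memLp_top_comp_snd [SFinite ν] (hφ : MemLp φ ⊤ ν) :
    MemLp (fun q : X × S => φ q.2) ⊤ (ρ.prod ν) :=
  memLp_top_of_bound hφ.1.comp_snd _
    (Measure.quasiMeasurePreserving_snd.ae (ae_le_lpNorm_exponent_top hφ))

end EssentiallyBounded

section Density

/-- Scheffé's lemma. -/
lemma tendsto_integral_abs_sub_of_tendsto {S ι : Type*} [MeasurableSpace S] {ν : Measure S}
    {L : Filter ι} [L.IsCountablyGenerated] {u : ι → S → ℝ} {v : S → ℝ}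
    (hu : ∀ i, Integrable (u i) ν) (hv : Integrable v ν) (hu0 : ∀ i, 0 ≤ᵐ[ν] u i)
    (hv0 : 0 ≤ᵐ[ν] v) (hint : ∀ i, ∫ z, u i z ∂ν = ∫ z, v z ∂ν)
    (hlim : ∀ᵐ z ∂ν, Tendsto (fun i => u i z) L (𝓝 (v z))) :
    Tendsto (fun i => ∫ z, |u i z - v z| ∂ν) L (𝓝 0) := by
  have habs (i : ι) : ∫ z, |u i z - v z| ∂ν = 2 * ∫ z, max (v z - u i z) 0 ∂ν := by
    have hi : Integrable (fun z => v z - u i z) ν := hv.sub (hu i)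
    have hz (z : S) : |u i z - v z| = 2 * max (v z - u i z) 0 - (v z - u i z) := by
      rcases le_total (u i z) (v z) with h | h
      · rw [abs_of_nonpos (by linarith), max_eq_left (by linarith)]; ring
      · rw [abs_of_nonneg (by linarith), max_eq_right (by linarith)]; ring
    simp_rw [hz]
    rw [integral_sub (hi.pos_part.const_mul 2) hi, integral_const_mul, integral_sub hv (hu i),
      hint, sub_self, sub_zero]
  have hpos : Tendsto (fun i => ∫ z, max (v z - u i z) 0 ∂ν) L (𝓝 (∫ _, (0 : ℝ) ∂ν)) := by
    refine tendsto_integral_filter_of_dominated_convergence v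
      (.of_forall fun i => (hv.sub (hu i)).pos_part.aestronglyMeasurable)
      (.of_forall fun i => ?_) hv ?_
    · filter_upwards [hu0 i, hv0] with z hz hz'
      rw [Real.norm_of_nonneg (le_max_right _ _)]
      exact max_le (sub_le_self _ hz) hz'
    · filter_upwards [hlim] with z hz
      simpa using (hz.const_sub (v z)).max (tendsto_const_nhds (x := (0 : ℝ)))
  simpa [habs] using hpos.const_mul 2

/-- A family of probability densities with respect to `ν`, depending continuously on a
parameter. -/
structure IsDensityFamily {X S : Type*} [TopologicalSpace X] [MeasurableSpace S] (ν : Measure S)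
    (f : X → S → ℝ) : Prop where
  continuous : ∀ z, Continuous fun x => f x z
  measurable : ∀ x, Measurable (f x)
  nonneg : ∀ x z, 0 ≤ f x z
  integral_eq_one : ∀ x, ∫ z, f x z ∂ν = 1

namespace IsDensityFamily

variable {X S : Type*} [TopologicalSpace X] [MeasurableSpace S] {ν : Measure S} {f : X → S → ℝ}
  {φ : S → ℝ}

protected lemma integrable (hf : IsDensityFamily ν f) (x : X) : Integrable (f x) ν :=
  integrable_of_integral_eq_one (hf.integral_eq_one x)

lemma integrable_mul (hf : IsDensityFamily ν f) (hφ : MemLp φ ⊤ ν) (x : X) :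
    Integrable (fun z => f x z * φ z) ν :=
  (hf.integrable x).mul_of_top_left hφ

lemma continuous_integral_mul [FirstCountableTopology X] (hf : IsDensityFamily ν f)
    (hφ : MemLp φ ⊤ ν) : Continuous fun x => ∫ z, f x z * φ z ∂ν := by
  refine continuous_iff_continuousAt.2 fun x₀ => ?_
  have hL1 : Tendsto (fun x => ∫ z, |f x z - f x₀ z| ∂ν) (𝓝 x₀) (𝓝 0) :=
    tendsto_integral_abs_sub_of_tendsto hf.integrable (hf.integrable x₀)
      (fun x => ae_of_all _ (hf.nonneg x)) (ae_of_all _ (hf.nonneg x₀))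
      (fun x => by rw [hf.integral_eq_one, hf.integral_eq_one])
      (ae_of_all _ fun z => (hf.continuous z).tendsto x₀)
  rw [ContinuousAt, tendsto_iff_norm_sub_tendsto_zero]
  refine squeeze_zero (fun _ => norm_nonneg _) (fun x => ?_)
    (by simpa using hL1.mul_const (lpNorm φ ⊤ ν))
  rw [← integral_sub (hf.integrable_mul hφ x) (hf.integrable_mul hφ x₀), ← integral_mul_const]
  refine norm_integral_le_of_norm_le
    (((hf.integrable x).sub (hf.integrable x₀)).abs.mul_const _) ?_
  filter_upwards [ae_le_lpNorm_exponent_top hφ] with z hz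
  rw [← sub_mul, norm_mul, Real.norm_eq_abs (f x z - f x₀ z)]
  gcongr

variable [TopologicalSpace.MetrizableSpace X] [SecondCountableTopology X] [MeasurableSpace X]
  [OpensMeasurableSpace X] {ρ : Measure X} {W : Type*} [NormedAddCommGroup W]
  [NormedSpace ℝ W] {u : X → W}

lemma measurable_uncurry (hf : IsDensityFamily ν f) : Measurable fun q : X × S => f q.1 q.2 :=
  measurable_uncurry_of_continuous_of_measurable (u := f) hf.continuous hf.measurable

lemma integrable_prod_smul [SFinite ν] (hf : IsDensityFamily ν f) (hφ : MemLp φ ⊤ ν)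
    (hu : Integrable u ρ) : Integrable (fun q => (f q.1 q.2 * φ q.2) • u q.1) (ρ.prod ν) := by
  have hm : AEStronglyMeasurable (fun q : X × S => f q.1 q.2 • u q.1) (ρ.prod ν) :=
    hf.measurable_uncurry.aestronglyMeasurable.smul hu.1.comp_fst
  have hfu : Integrable (fun q : X × S => f q.1 q.2 • u q.1) (ρ.prod ν) := by
    refine (integrable_prod_iff hm).2
      ⟨ae_of_all _ fun x => (hf.integrable x).smul_const (u x), hu.norm.congr ?_⟩
    refine ae_of_all _ fun x => ?_
    simp only [norm_smul, integral_mul_const, Real.norm_of_nonneg (hf.nonneg _ _),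
      hf.integral_eq_one, one_mul]
  refine (hfu.smul_of_top_right (memLp_top_comp_snd hφ)).congr (ae_of_all _ fun q => ?_)
  change φ q.2 • f q.1 q.2 • u q.1 = (f q.1 q.2 * φ q.2) • u q.1
  rw [smul_smul, mul_comm]

lemma integral_prod_smul [SFinite ν] [SFinite ρ] [CompleteSpace W] (hf : IsDensityFamily ν f)
    (hφ : MemLp φ ⊤ ν) (hu : Integrable u ρ) :
    ∫ q, (f q.1 q.2 * φ q.2) • u q.1 ∂ρ.prod ν = ∫ x, (∫ z, f x z * φ z ∂ν) • u x ∂ρ := by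
  rw [integral_prod _ (hf.integrable_prod_smul hφ hu)]
  simp_rw [integral_smul_const]

end IsDensityFamily

end Density

section RandomizedLaw

variable {d n : ℕ} {f : EuclideanSpace ℝ (Fin d) → EuclideanSpace ℝ (Fin n) → ℝ}
  {φ : EuclideanSpace ℝ (Fin n) → ℝ} {x₀ : EuclideanSpace ℝ (Fin d)}
  {ℓ : EuclideanSpace ℝ (Fin d) → ℝ} {W : Type*} [NormedAddCommGroup W] [NormedSpace ℝ W]

lemma randomizedLaw_absolutelyContinuous : randomizedLaw x₀ ℓ f ≪ volume :=
  withDensity_absolutelyContinuous _ _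

lemma integrable_randomizedLaw_iff (hf : Measurable fun q :
      EuclideanSpace ℝ (Fin d) × EuclideanSpace ℝ (Fin n) => f q.1 q.2) (hf0 : ∀ x z, 0 ≤ f x z)
    (hℓ : Measurable ℓ) (hℓ0 : ∀ x, 0 ≤ ℓ x)
    {F : EuclideanSpace ℝ (Fin d) × EuclideanSpace ℝ (Fin n) → W} :
    Integrable F (randomizedLaw x₀ ℓ f) ↔
      Integrable (fun q => (ℓ (x₀ - q.1) * f q.1 q.2) • F q) := by
  rw [randomizedLaw, integrable_withDensity_iff_integrable_smul' (by fun_prop) (by simp)]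
  simp only [ENNReal.toReal_ofReal (mul_nonneg (hℓ0 _) (hf0 _ _))]

lemma integral_randomizedLaw (hf : Measurable fun q :
      EuclideanSpace ℝ (Fin d) × EuclideanSpace ℝ (Fin n) => f q.1 q.2) (hf0 : ∀ x z, 0 ≤ f x z)
    (hℓ : Measurable ℓ) (hℓ0 : ∀ x, 0 ≤ ℓ x)
    {F : EuclideanSpace ℝ (Fin d) × EuclideanSpace ℝ (Fin n) → W} :
    ∫ q, F q ∂randomizedLaw x₀ ℓ f = ∫ q, (ℓ (x₀ - q.1) * f q.1 q.2) • F q := by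
  rw [randomizedLaw, integral_withDensity_eq_integral_toReal_smul (by fun_prop) (by simp)]
  simp only [ENNReal.toReal_ofReal (mul_nonneg (hℓ0 _) (hf0 _ _))]

section Rescaled

variable {G : EuclideanSpace ℝ (Fin d) → W} {h : ℝ}

lemma integral_comp_rescale (G : EuclideanSpace ℝ (Fin d) → W) (x₀ : EuclideanSpace ℝ (Fin d))
    (hh : 0 < h) : ∫ x, G (h⁻¹ • (x₀ - x)) = h ^ d • ∫ l, G l := by
  rw [integral_sub_left_eq_self (fun y => G (h⁻¹ • y)) volume x₀, Measure.integral_comp_inv_smul]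
  simp [abs_of_pos hh]

lemma integrable_comp_rescale {V : Type*} [NormedAddCommGroup V]
    {G : EuclideanSpace ℝ (Fin d) → V} (hG : Integrable G) (x₀ : EuclideanSpace ℝ (Fin d))
    (hh : h ≠ 0) : Integrable fun x => G (h⁻¹ • (x₀ - x)) :=
  (hG.comp_smul (inv_ne_zero hh)).comp_sub_left x₀

lemma randomizedLaw_density_smul_rescaled (hh : h ≠ 0)
    (q : EuclideanSpace ℝ (Fin d) × EuclideanSpace ℝ (Fin n)) :
    (ℓ (x₀ - q.1) * f q.1 q.2) • φ q.2 • G (h⁻¹ • (x₀ - q.1)) =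
      (f q.1 q.2 * φ q.2) • (fun l => ℓ (h • l) • G l) (h⁻¹ • (x₀ - q.1)) := by
  simp only [smul_smul, smul_inv_smul₀ hh]
  congr 1
  ring

lemma integrable_randomizedLaw_rescaled (hf : IsDensityFamily volume f) (hℓ : Measurable ℓ)
    (hℓ0 : ∀ x, 0 ≤ ℓ x) (hφ : MemLp φ ⊤ volume) (hG : Integrable fun l => ℓ (h • l) • G l)
    (hh : h ≠ 0) :
    Integrable (fun q => φ q.2 • G (h⁻¹ • (x₀ - q.1))) (randomizedLaw x₀ ℓ f) := by
  rw [integrable_randomizedLaw_iff hf.measurable_uncurry hf.nonneg hℓ hℓ0]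
  simp only [randomizedLaw_density_smul_rescaled hh]
  exact hf.integrable_prod_smul hφ (integrable_comp_rescale hG x₀ hh)

lemma integral_randomizedLaw_rescaled [CompleteSpace W] (hf : IsDensityFamily volume f)
    (hℓ : Measurable ℓ) (hℓ0 : ∀ x, 0 ≤ ℓ x) (hφ : MemLp φ ⊤ volume)
    (hG : Integrable fun l => ℓ (h • l) • G l) (hh : 0 < h) :
    ∫ q, φ q.2 • G (h⁻¹ • (x₀ - q.1)) ∂randomizedLaw x₀ ℓ f =
      h ^ d • ∫ l, (∫ z, f (x₀ - h • l) z * φ z) • ℓ (h • l) • G l := by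
  rw [integral_randomizedLaw hf.measurable_uncurry hf.nonneg hℓ hℓ0]
  simp only [randomizedLaw_density_smul_rescaled hh.ne']
  rw [Measure.volume_eq_prod,
    hf.integral_prod_smul hφ (integrable_comp_rescale hG x₀ hh.ne'),
    ← integral_comp_rescale _ x₀ hh]
  simp only [smul_inv_smul₀ hh.ne', sub_sub_cancel]

end Rescaled

end RandomizedLaw

section ParametricIntegral

variable {Y X W : Type*} [TopologicalSpace Y] [TopologicalSpace X] [NormedAddCommGroup W]
  {F : Y → X → W} {y₀ : Y} {S : Set X}

lemma exists_eventually_norm_le_of_continuousAt (hS : IsCompact S)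
    (hF : ∀ x ∈ S, ContinuousAt (Function.uncurry F) (y₀, x)) :
    ∃ C, ∀ᶠ y in 𝓝 y₀, ∀ x ∈ S, ‖F y x‖ ≤ C := by
  have hF₀ : ContinuousOn (F y₀) S := fun x hx =>
    ((hF x hx).comp (f := fun x => (y₀, x)) (by fun_prop)).continuousWithinAt
  obtain ⟨C, hC⟩ := hS.exists_bound_of_continuousOn hF₀
  refine ⟨C + 1, hS.eventually_forall_of_forall_eventually fun x hx => ?_⟩
  filter_upwards [(hF x hx).norm.eventually_lt_const ((hC x hx).trans_lt (lt_add_one C))] with q hq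
    using hq.le

variable [T2Space X] [MeasurableSpace X] [BorelSpace X] {μ : Measure X}
  [IsFiniteMeasureOnCompacts μ]

lemma eventually_integrable_of_continuousAt (hS : IsCompact S)
    (hFm : ∀ y, AEStronglyMeasurable (F y) μ) (hF0 : ∀ y, ∀ x ∉ S, F y x = 0)
    (hF : ∀ x ∈ S, ContinuousAt (Function.uncurry F) (y₀, x)) :
    ∀ᶠ y in 𝓝 y₀, Integrable (F y) μ := by
  obtain ⟨C, hC⟩ := exists_eventually_norm_le_of_continuousAt hS hF
  filter_upwards [hC] with y hy
  have hsupp : Function.support (F y) ⊆ S := fun x hx => by_contra fun hxS => hx (hF0 y x hxS)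
  exact (integrableOn_iff_integrable_of_support_subset hsupp).1
    (.of_bound hS.measure_lt_top (hFm y).restrict C (ae_restrict_of_forall_mem hS.measurableSet hy))

lemma tendsto_integral_of_continuousAt [FirstCountableTopology Y] [NormedSpace ℝ W]
    (hS : IsCompact S) (hFm : ∀ y, AEStronglyMeasurable (F y) μ)
    (hF0 : ∀ y, ∀ x ∉ S, F y x = 0) (hF : ∀ x ∈ S, ContinuousAt (Function.uncurry F) (y₀, x)) :
    Tendsto (fun y => ∫ x, F y x ∂μ) (𝓝 y₀) (𝓝 (∫ x, F y₀ x ∂μ)) := by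
  obtain ⟨C, hC⟩ := exists_eventually_norm_le_of_continuousAt hS hF
  refine tendsto_integral_filter_of_dominated_convergence (S.indicator fun _ => C)
    (.of_forall hFm) ?_ ?_ (ae_of_all _ fun x => ?_)
  · filter_upwards [hC] with y hy
    refine ae_of_all _ fun x => ?_
    by_cases hx : x ∈ S
    · simpa [hx] using hy x hx
    · simp [hx, hF0 y x hx]
  · exact (integrable_indicator_iff hS.measurableSet).2 (integrableOn_const hS.measure_lt_top.ne)
  · by_cases hx : x ∈ S
    · exact (hF x hx).comp (f := fun y => (y, x)) (by fun_prop)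
    · simp only [hF0 _ x hx, tendsto_const_nhds]

end ParametricIntegral

section Gradient

variable {E : Type*} [NormedAddCommGroup E] [InnerProductSpace ℝ E] [CompleteSpace E] {u v : E → ℝ}

lemma continuous_gradient (hu : ContDiff ℝ 1 u) : Continuous (gradient u) :=
  (InnerProductSpace.toDual ℝ E).symm.continuous.comp (hu.continuous_fderiv one_ne_zero)

lemma gradient_of_notMem_tsupport {x : E} (hx : x ∉ tsupport u) : gradient u x = 0 := by
  rw [gradient, fderiv_of_notMem_tsupport ℝ hx, map_zero]

lemma hasCompactSupport_gradient (hu : HasCompactSupport u) : HasCompactSupport (gradient u) :=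
  HasCompactSupport.intro hu fun _ => gradient_of_notMem_tsupport

lemma mul_inv_smul_gradient (hu : ∀ x, 0 ≤ u x) (x : E) :
    u x • ((u x)⁻¹ • gradient u x) = gradient u x := by
  by_cases hx : u x = 0
  · have hmin : IsLocalMin u x := .of_forall fun y => hx ▸ hu y
    rw [gradient, hmin.fderiv_eq_zero, map_zero, smul_zero, smul_zero]
  · rw [smul_inv_smul₀ hx]

lemma integral_smul_gradient_eq_neg [MeasurableSpace E] [BorelSpace E] [FiniteDimensional ℝ E]
    {μ : Measure E} [μ.IsAddHaarMeasure] (hu : ContDiff ℝ 1 u) (huc : HasCompactSupport u)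
    (hv : ContDiff ℝ 1 v) : ∫ x, v x • gradient u x ∂μ = -∫ x, u x • gradient v x ∂μ := by
  have hvu : Integrable (fun x => v x • gradient u x) μ :=
    (hv.continuous.smul (continuous_gradient hu)).integrable_of_hasCompactSupport
      (hasCompactSupport_gradient huc).smul_left
  have huv : Integrable (fun x => u x • gradient v x) μ :=
    (hu.continuous.smul (continuous_gradient hv)).integrable_of_hasCompactSupport huc.smul_right
  have hvu' : Integrable (fun x => u x * v x) μ :=
    (hu.continuous.mul hv.continuous).integrable_of_hasCompactSupport huc.mul_right
  refine ext_inner_left ℝ fun t => ?_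
  have hparts := integral_mul_fderiv_eq_neg_fderiv_mul_of_integrable (μ := μ) (f := u) (g := v)
    (v := t) ?_ ?_ hvu' (fun x _ => hu.differentiable one_ne_zero x)
    (fun x _ => hv.differentiable one_ne_zero x)
  · rw [inner_neg_right, ← integral_inner hvu, ← integral_inner huv]
    simp only [inner_smul_right, inner_gradient_right, conj_trivial, hparts, neg_neg, mul_comm]
  · simpa only [inner_smul_right, inner_gradient_right, conj_trivial, mul_comm]
      using Integrable.const_inner (𝕜 := ℝ) t hvu
  · simpa only [inner_smul_right, inner_gradient_right, conj_trivial]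
      using Integrable.const_inner (𝕜 := ℝ) t huv

lemma integral_gradient_eq_zero [MeasurableSpace E] [BorelSpace E] [FiniteDimensional ℝ E]
    {μ : Measure E} [μ.IsAddHaarMeasure] (hu : ContDiff ℝ 1 u) (huc : HasCompactSupport u) :
    ∫ x, gradient u x ∂μ = 0 := by
  simpa [gradient_fun_const] using
    integral_smul_gradient_eq_neg (μ := μ) hu huc (contDiff_const (c := (1 : ℝ)))

end Gradient

section Score

variable {E : Type*} [NormedAddCommGroup E] [InnerProductSpace ℝ E] [CompleteSpace E] {K ℓ : E → ℝ}

/-- The summand of the estimator without its payoff, as a function of the rescaled variable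
`l = (x₀ - x) / h`. -/
def rescaledScore (K ℓ : E → ℝ) (h : ℝ) (l : E) : E :=
  gradient K l + (h * K l) • ((ℓ (h • l))⁻¹ • gradient ℓ (h • l))

lemma rescaledScore_of_notMem_tsupport {l : E} (hl : l ∉ tsupport K) (h : ℝ) :
    rescaledScore K ℓ h l = 0 := by
  simp [rescaledScore, gradient_of_notMem_tsupport hl, image_eq_zero_of_notMem_tsupport hl]

lemma rescaledScore_zero (l : E) : rescaledScore K ℓ 0 l = gradient K l := by
  simp [rescaledScore]

lemma smul_rescaledScore (hℓ0 : ∀ x, 0 ≤ ℓ x) (h : ℝ) (l : E) :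
    ℓ (h • l) • rescaledScore K ℓ h l =
      ℓ (h • l) • gradient K l + (h * K l) • gradient ℓ (h • l) := by
  rw [rescaledScore, smul_add, smul_comm _ (h * K l), mul_inv_smul_gradient hℓ0]

lemma measurable_rescaledScore [MeasurableSpace E] [BorelSpace E] [SecondCountableTopology E]
    (hK : ContDiff ℝ 1 K) (hℓ : ContDiff ℝ 1 ℓ) (h : ℝ) : Measurable (rescaledScore K ℓ h) := by
  have hK' := (continuous_gradient hK).measurable
  have hℓ' := (continuous_gradient hℓ).measurable
  have hKm := hK.continuous.measurable
  have hℓm := hℓ.continuous.measurable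
  unfold rescaledScore
  fun_prop

lemma continuousAt_rescaledScore (hK : ContDiff ℝ 1 K) (hℓ : ContDiff ℝ 1 ℓ) (hℓ_zero : ℓ 0 ≠ 0)
    (l : E) : ContinuousAt (fun q : ℝ × E => rescaledScore K ℓ q.1 q.2) (0, l) := by
  have hK' := continuous_gradient hK
  have hℓ' := continuous_gradient hℓ
  have hKc := hK.continuous
  have hℓinv : ContinuousAt (fun q : ℝ × E => (ℓ (q.1 • q.2))⁻¹) (0, l) :=
    (hℓ.continuous.comp (by fun_prop)).continuousAt.inv₀ (by simpa using hℓ_zero)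
  exact (by fun_prop : Continuous fun q : ℝ × E => gradient K q.2).continuousAt.add
    ((by fun_prop : Continuous fun q : ℝ × E => q.1 * K q.2).continuousAt.smul
      (hℓinv.smul (by fun_prop : Continuous fun q : ℝ × E => gradient ℓ (q.1 • q.2)).continuousAt))

lemma exists_eventually_norm_rescaledScore_le (hK : ContDiff ℝ 1 K) (hKc : HasCompactSupport K)
    (hℓ : ContDiff ℝ 1 ℓ) (hℓ_zero : ℓ 0 ≠ 0) :
    ∃ B, ∀ᶠ h in 𝓝 (0 : ℝ), ∀ l, ‖rescaledScore K ℓ h l‖ ≤ B := by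
  obtain ⟨B, hB⟩ := exists_eventually_norm_le_of_continuousAt (F := rescaledScore K ℓ) (y₀ := 0)
    hKc.isCompact fun l _ => continuousAt_rescaledScore hK hℓ hℓ_zero l
  refine ⟨max B 0, ?_⟩
  filter_upwards [hB] with h hB l
  by_cases hl : l ∈ tsupport K
  · exact (hB l hl).trans (le_max_left _ _)
  · rw [rescaledScore_of_notMem_tsupport hl, norm_zero]
    exact le_max_right _ _

variable [MeasurableSpace E] [BorelSpace E] {μ : Measure E} [IsFiniteMeasureOnCompacts μ]

lemma integrable_smul_rescaledScore (hK : ContDiff ℝ 1 K) (hKc : HasCompactSupport K)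
    (hℓ : ContDiff ℝ 1 ℓ) (hℓ0 : ∀ x, 0 ≤ ℓ x) (h : ℝ) :
    Integrable (fun l => ℓ (h • l) • rescaledScore K ℓ h l) μ := by
  have hK' := continuous_gradient hK
  have hℓ' := continuous_gradient hℓ
  have hKcont := hK.continuous
  have hℓcont := hℓ.continuous
  simp only [smul_rescaledScore hℓ0]
  refine Continuous.integrable_of_hasCompactSupport (by fun_prop) (.intro hKc fun l hl => ?_)
  simp [gradient_of_notMem_tsupport hl, image_eq_zero_of_notMem_tsupport hl]

variable [FiniteDimensional ℝ E] {k : ℕ} (t : E)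

lemma eventually_integrable_smul_inner_rescaledScore_pow (hK : ContDiff ℝ 1 K)
    (hKc : HasCompactSupport K) (hℓ : ContDiff ℝ 1 ℓ) (hℓ_zero : ℓ 0 ≠ 0) (hk : k ≠ 0) :
    ∀ᶠ h in 𝓝 (0 : ℝ), Integrable (fun l => ℓ (h • l) • ⟪rescaledScore K ℓ h l, t⟫_ℝ ^ k) μ := by
  refine eventually_integrable_of_continuousAt hKc.isCompact (fun h => ?_) (fun h l hl => ?_)
    fun l _ => ?_
  · have hs := measurable_rescaledScore hK hℓ h
    have hℓm := hℓ.continuous.measurable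
    exact Measurable.aestronglyMeasurable (by fun_prop)
  · simp [rescaledScore_of_notMem_tsupport hl, hk]
  · have hℓc : Continuous fun q : ℝ × E => ℓ (q.1 • q.2) := hℓ.continuous.comp (by fun_prop)
    exact hℓc.continuousAt.smul
      (((continuousAt_rescaledScore hK hℓ hℓ_zero l).inner continuousAt_const).pow k)

lemma tendsto_integral_inner_rescaledScore_pow (hK : ContDiff ℝ 1 K) (hKc : HasCompactSupport K)
    (hℓ : ContDiff ℝ 1 ℓ) (hℓ_zero : ℓ 0 ≠ 0) {m : E → ℝ} (hm : Continuous m) (x₀ : E)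
    (hk : k ≠ 0) :
    Tendsto (fun h : ℝ => ∫ l, m (x₀ - h • l) • ℓ (h • l) • ⟪rescaledScore K ℓ h l, t⟫_ℝ ^ k ∂μ)
      (𝓝 0) (𝓝 (m x₀ * (ℓ 0 * ∫ l, ⟪gradient K l, t⟫_ℝ ^ k ∂μ))) := by
  have hlim := tendsto_integral_of_continuousAt (y₀ := (0 : ℝ)) (μ := μ)
    (F := fun h l => m (x₀ - h • l) • ℓ (h • l) • ⟪rescaledScore K ℓ h l, t⟫_ℝ ^ k)
    hKc.isCompact (fun h => ?_) (fun h l hl => ?_) fun l _ => ?_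
  · simpa only [zero_smul, sub_zero, rescaledScore_zero, smul_eq_mul, integral_const_mul] using hlim
  · have hs := measurable_rescaledScore hK hℓ h
    have hmm := hm.measurable
    have hℓm := hℓ.continuous.measurable
    exact Measurable.aestronglyMeasurable (by fun_prop)
  · simp [rescaledScore_of_notMem_tsupport hl, hk]
  · have hmc : Continuous fun q : ℝ × E => m (x₀ - q.1 • q.2) := by fun_prop
    have hℓc : Continuous fun q : ℝ × E => ℓ (q.1 • q.2) := hℓ.continuous.comp (by fun_prop)
    exact hmc.continuousAt.smul (hℓc.continuousAt.smul
      (((continuousAt_rescaledScore hK hℓ hℓ_zero l).inner continuousAt_const).pow k))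

end Score

section Covariance

variable {d : ℕ} {K ℓ : EuclideanSpace ℝ (Fin d) → ℝ}

lemma dotProduct_asymptoticCov_mulVec (hK : ContDiff ℝ 1 K) (hKc : HasCompactSupport K) (m : ℝ)
    (t : EuclideanSpace ℝ (Fin d)) :
    t ⬝ᵥ asymptoticCov K ℓ m *ᵥ t = m / ℓ 0 * ∫ l, ⟪gradient K l, t⟫_ℝ ^ 2 := by
  have hg := continuous_gradient hK
  have hint (i j : Fin d) : Integrable fun l => gradient K l i * gradient K l j := by
    refine Continuous.integrable_of_hasCompactSupport (by fun_prop) (.intro hKc fun x hx => ?_)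
    simp [gradient_of_notMem_tsupport hx]
  have hexpand (l : EuclideanSpace ℝ (Fin d)) : ⟪gradient K l, t⟫_ℝ ^ 2 =
      ∑ i, ∑ j, t i * t j * (gradient K l i * gradient K l j) := by
    rw [PiLp.inner_apply, sq, Finset.sum_mul_sum]
    refine Finset.sum_congr rfl fun i _ => Finset.sum_congr rfl fun j _ => ?_
    simp only [RCLike.inner_apply, conj_trivial]
    ring
  simp_rw [hexpand]
  rw [integral_finsetSum _ fun i _ => integrable_finsetSum _ fun j _ => (hint i j).const_mul _]
  simp_rw [integral_finsetSum _ fun j _ => (hint _ j).const_mul _, integral_const_mul]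
  simp only [asymptoticCov, dotProduct, Matrix.mulVec, Matrix.smul_apply, Matrix.of_apply,
    smul_eq_mul, Finset.mul_sum]
  refine Finset.sum_congr rfl fun i _ => Finset.sum_congr rfl fun j _ => ?_
  ring

lemma posSemidef_asymptoticCov (hK : ContDiff ℝ 1 K) (hKc : HasCompactSupport K) {m : ℝ}
    (hm : 0 ≤ m) (hℓ : 0 ≤ ℓ 0) : (asymptoticCov K ℓ m).PosSemidef := by
  refine .of_dotProduct_mulVec_nonneg ?_ fun t => ?_
  · ext i j
    simp [asymptoticCov, mul_comm]
  · rw [star_trivial, dotProduct_asymptoticCov_mulVec hK hKc m (WithLp.toLp 2 t)]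
    exact mul_nonneg (div_nonneg hm hℓ) (integral_nonneg fun _ => sq_nonneg _)

end Covariance

section Summand

variable {d n : ℕ} {K ℓ : EuclideanSpace ℝ (Fin d) → ℝ}
  {f : EuclideanSpace ℝ (Fin d) → EuclideanSpace ℝ (Fin n) → ℝ}
  {φ : EuclideanSpace ℝ (Fin n) → ℝ} {x₀ : EuclideanSpace ℝ (Fin d)} {h : ℝ}

/-- The term which a sample point `q = (x, z)` contributes to the sum in `betaHat`. -/
def summand (K ℓ : EuclideanSpace ℝ (Fin d) → ℝ) (φ : EuclideanSpace ℝ (Fin n) → ℝ)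
    (x₀ : EuclideanSpace ℝ (Fin d)) (h : ℝ)
    (q : EuclideanSpace ℝ (Fin d) × EuclideanSpace ℝ (Fin n)) : EuclideanSpace ℝ (Fin d) :=
  φ q.2 • rescaledScore K ℓ h (h⁻¹ • (x₀ - q.1))

lemma betaHat_eq_smul_sum (hh : h ≠ 0) (N : ℕ) (x : ℕ → EuclideanSpace ℝ (Fin d))
    (z : ℕ → EuclideanSpace ℝ (Fin n)) :
    betaHat K ℓ φ x₀ N h x z =
      (1 / (ℓ 0 * N * h ^ (d + 1))) • ∑ i ∈ Finset.range N, summand K ℓ φ x₀ h (x i, z i) := by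
  simp only [betaHat, summand, rescaledScore, smul_inv_smul₀ hh]

lemma ae_norm_summand_le {B : ℝ} (hφ : MemLp φ ⊤ volume)
    (hB : ∀ l, ‖rescaledScore K ℓ h l‖ ≤ B) :
    ∀ᵐ q ∂randomizedLaw x₀ ℓ f, ‖summand K ℓ φ x₀ h q‖ ≤ lpNorm φ ⊤ volume * B := by
  refine randomizedLaw_absolutelyContinuous.ae_le ?_
  rw [Measure.volume_eq_prod]
  filter_upwards [Measure.quasiMeasurePreserving_snd.ae (ae_le_lpNorm_exponent_top hφ)] with q hq
  rw [summand, norm_smul]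
  gcongr
  · exact lpNorm_nonneg
  · exact hB _

variable (hf : IsDensityFamily volume f) (hK : ContDiff ℝ 1 K) (hKc : HasCompactSupport K)
  (hℓ : ContDiff ℝ 1 ℓ) (hℓ0 : ∀ x, 0 ≤ ℓ x) (hφ : MemLp φ ⊤ volume)
include hf hK hKc hℓ hℓ0 hφ

lemma integrable_summand (hh : h ≠ 0) :
    Integrable (summand K ℓ φ x₀ h) (randomizedLaw x₀ ℓ f) :=
  integrable_randomizedLaw_rescaled hf hℓ.continuous.measurable hℓ0 hφ
    (integrable_smul_rescaledScore hK hKc hℓ hℓ0 h) hh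

variable (x₀) in
lemma tendsto_integral_inner_summand_pow (hℓ_zero : ℓ 0 ≠ 0) (t : EuclideanSpace ℝ (Fin d))
    {k : ℕ} (hk : k ≠ 0) :
    Tendsto (fun h => (h ^ d)⁻¹ * ∫ q, ⟪summand K ℓ φ x₀ h q, t⟫_ℝ ^ k ∂randomizedLaw x₀ ℓ f)
      (𝓝[>] 0)
      (𝓝 ((∫ z, f x₀ z * φ z ^ k) * (ℓ 0 * ∫ l, ⟪gradient K l, t⟫_ℝ ^ k))) := by
  have hφk := memLp_top_pow hφ k
  have hlim := tendsto_integral_inner_rescaledScore_pow (μ := volume) t hK hKc hℓ hℓ_zero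
    (hf.continuous_integral_mul hφk) x₀ hk
  have hint := eventually_integrable_smul_inner_rescaledScore_pow (μ := volume) t hK hKc hℓ
    hℓ_zero hk
  refine (hlim.mono_left nhdsWithin_le_nhds).congr' ?_
  filter_upwards [self_mem_nhdsWithin, nhdsWithin_le_nhds hint] with h (hh : 0 < h) hG
  have hpow (q : EuclideanSpace ℝ (Fin d) × EuclideanSpace ℝ (Fin n)) :
      ⟪summand K ℓ φ x₀ h q, t⟫_ℝ ^ k =
        φ q.2 ^ k • ⟪rescaledScore K ℓ h (h⁻¹ • (x₀ - q.1)), t⟫_ℝ ^ k := by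
    rw [summand, real_inner_smul_left, mul_pow, smul_eq_mul]
  simp_rw [hpow]
  rw [integral_randomizedLaw_rescaled hf hℓ.continuous.measurable hℓ0 hφk hG hh, smul_eq_mul,
    inv_mul_cancel_left₀ (pow_pos hh d).ne']

-- The squared mean is negligible because `∫ ∇K = 0`: after division by `h ^ d` it is `h ^ d`
-- times the square of a quantity tending to `0`.
lemma tendsto_variance_inner_summand [IsProbabilityMeasure (randomizedLaw x₀ ℓ f)]
    (hℓ_zero : ℓ 0 ≠ 0) (t : EuclideanSpace ℝ (Fin d)) :
    Tendsto
      (fun h => (h ^ d)⁻¹ * Var[fun q => ⟪summand K ℓ φ x₀ h q, t⟫_ℝ; randomizedLaw x₀ ℓ f])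
      (𝓝[>] 0) (𝓝 ((∫ z, f x₀ z * φ z ^ 2) * (ℓ 0 * ∫ l, ⟪gradient K l, t⟫_ℝ ^ 2))) := by
  have hmean := tendsto_integral_inner_summand_pow x₀ hf hK hKc hℓ hℓ0 hφ hℓ_zero t one_ne_zero
  have hsq := tendsto_integral_inner_summand_pow x₀ hf hK hKc hℓ hℓ0 hφ hℓ_zero t two_ne_zero
  have hgrad : ∫ l, ⟪gradient K l, t⟫_ℝ = 0 := by
    have hi : Integrable (gradient K) := (continuous_gradient hK).integrable_of_hasCompactSupport
      (hasCompactSupport_gradient hKc)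
    simp only [real_inner_comm t, integral_inner hi, integral_gradient_eq_zero hK hKc,
      inner_zero_right]
  simp only [pow_one, hgrad, mul_zero] at hmean
  have hh_pow : Tendsto (fun h : ℝ => h ^ d) (𝓝[>] 0) (𝓝 (0 ^ d)) :=
    ((continuous_pow d).tendsto 0).mono_left nhdsWithin_le_nhds
  have hlim := hsq.sub (hh_pow.mul (hmean.pow 2))
  rw [zero_pow two_ne_zero, mul_zero, sub_zero] at hlim
  obtain ⟨B, hB⟩ := exists_eventually_norm_rescaledScore_le hK hKc hℓ hℓ_zero
  refine hlim.congr' ?_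
  filter_upwards [self_mem_nhdsWithin, nhdsWithin_le_nhds hB] with h (hh : 0 < h) hB
  have hY : MemLp (summand K ℓ φ x₀ h) 2 (randomizedLaw x₀ ℓ f) :=
    .of_bound (integrable_summand hf hK hKc hℓ hℓ0 hφ hh.ne').1 _ (ae_norm_summand_le hφ hB)
  rw [variance_eq_sub (hY.inner_const t)]
  have := (pow_pos hh d).ne'
  simp only [Pi.pow_apply]
  field_simp

end Summand

section AsymptoticNormality

variable {d n : ℕ} {Ω : Type*} [MeasurableSpace Ω] {P : Measure Ω}
  {K ℓ : EuclideanSpace ℝ (Fin d) → ℝ}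
  {f : EuclideanSpace ℝ (Fin d) → EuclideanSpace ℝ (Fin n) → ℝ}
  {φ : EuclideanSpace ℝ (Fin n) → ℝ} {x₀ : EuclideanSpace ℝ (Fin d)}
  {Λ : ℕ → Ω → EuclideanSpace ℝ (Fin d)} {Zs : ℕ → Ω → EuclideanSpace ℝ (Fin n)}

lemma mul_sq_sqrt_mul_one_div {c h : ℝ} {N : ℕ} (hh : 0 < h) (hN : N ≠ 0) (d : ℕ) :
    N * (√(N * h ^ (d + 2)) * (1 / (c * N * h ^ (d + 1)))) ^ 2 = (c ^ 2)⁻¹ * (h ^ d)⁻¹ := by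
  rcases eq_or_ne c 0 with rfl | hc
  · simp
  have hN' : (N : ℝ) ≠ 0 := Nat.cast_ne_zero.2 hN
  rw [mul_pow, Real.sq_sqrt (by positivity)]
  field_simp
  ring

lemma tendsto_sqrt_mul_one_div {h : ℕ → ℝ} (h_pos : ∀ N, 0 < h N) (h_zero : Tendsto h atTop (𝓝 0))
    (h_rate : Tendsto (fun N : ℕ => N * h N ^ (d + 2)) atTop atTop) (c : ℝ) :
    Tendsto (fun N : ℕ => √(N * h N ^ (d + 2)) * (1 / (c * N * h N ^ (d + 1)))) atTop (𝓝 0) := by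
  have hrate : Tendsto (fun N : ℕ => N * h N ^ d) atTop atTop := by
    refine tendsto_atTop_mono' _ ?_ h_rate
    filter_upwards [h_zero.eventually_le_const one_pos] with N hN
    exact mul_le_mul_of_nonneg_left (pow_le_pow_of_le_one (h_pos N).le hN (by omega))
      (Nat.cast_nonneg N)
  have hsq := hrate.inv_tendsto_atTop.const_mul (c ^ 2)⁻¹
  rw [mul_zero] at hsq
  rw [tendsto_zero_iff_abs_tendsto_zero]
  refine ((Real.sqrt_zero ▸ hsq.sqrt).congr' ?_)
  filter_upwards [eventually_ne_atTop 0] with N hN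
  have hN' : (N : ℝ) ≠ 0 := Nat.cast_ne_zero.2 hN
  rw [Function.comp_apply, ← Real.sqrt_sq_eq_abs, Pi.inv_apply, mul_inv, mul_left_comm,
    ← mul_sq_sqrt_mul_one_div (h_pos N) hN, inv_mul_cancel_left₀ hN']

variable (hf : IsDensityFamily volume f) (hK : ContDiff ℝ 1 K) (hKc : HasCompactSupport K)
  (hℓ : ContDiff ℝ 1 ℓ) (hℓ0 : ∀ x, 0 ≤ ℓ x) (hφ : MemLp φ ⊤ volume)
  (h_law : ∀ i, HasLaw (fun ω => (Λ i ω, Zs i ω)) (randomizedLaw x₀ ℓ f) P)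
include hf hK hKc hℓ hℓ0 hφ h_law

lemma integrable_summand_comp {h : ℝ} (hh : h ≠ 0) (i : ℕ) :
    Integrable (fun ω => summand K ℓ φ x₀ h (Λ i ω, Zs i ω)) P := by
  have hi := integrable_summand (x₀ := x₀) hf hK hKc hℓ hℓ0 hφ hh
  rw [← (h_law i).map_eq] at hi
  exact hi.comp_aemeasurable (h_law i).aemeasurable

lemma integrable_betaHat {h : ℝ} (hh : h ≠ 0) (N : ℕ) :
    Integrable (fun ω => betaHat K ℓ φ x₀ N h (fun i => Λ i ω) (fun i => Zs i ω)) P := by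
  simp_rw [betaHat_eq_smul_sum hh]
  exact (integrable_finsetSum _ fun i _ =>
    integrable_summand_comp hf hK hKc hℓ hℓ0 hφ h_law hh i).fun_smul _

lemma integral_betaHat {h : ℝ} (hh : h ≠ 0) (N : ℕ) :
    ∫ ω, betaHat K ℓ φ x₀ N h (fun i => Λ i ω) (fun i => Zs i ω) ∂P =
      (1 / (ℓ 0 * N * h ^ (d + 1))) • N • ∫ q, summand K ℓ φ x₀ h q ∂randomizedLaw x₀ ℓ f := by
  simp_rw [betaHat_eq_smul_sum hh]
  have hY := (integrable_summand (x₀ := x₀) hf hK hKc hℓ hℓ0 hφ hh).aestronglyMeasurable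
  have hcomp (i : ℕ) : ∫ ω, summand K ℓ φ x₀ h (Λ i ω, Zs i ω) ∂P =
      ∫ q, summand K ℓ φ x₀ h q ∂randomizedLaw x₀ ℓ f := (h_law i).integral_comp hY
  rw [integral_smul, integral_finsetSum _ fun i _ =>
    integrable_summand_comp hf hK hKc hℓ hℓ0 hφ h_law hh i]
  simp only [hcomp, Finset.sum_const, Finset.card_range]

theorem tendstoInDistribution_betaHat_sub_integral [IsProbabilityMeasure P] (hℓ_zero : ℓ 0 ≠ 0)
    (h_indep : iIndepFun (fun i ω => (Λ i ω, Zs i ω)) P)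
    {h : ℕ → ℝ} (h_pos : ∀ N, 0 < h N) (h_zero : Tendsto h atTop (𝓝 0))
    (h_rate : Tendsto (fun N : ℕ => N * h N ^ (d + 2)) atTop atTop) :
    TendstoInDistribution (fun (N : ℕ) ω => √(N * h N ^ (d + 2)) •
        (betaHat K ℓ φ x₀ N (h N) (fun i => Λ i ω) (fun i => Zs i ω) -
          ∫ ω', betaHat K ℓ φ x₀ N (h N) (fun i => Λ i ω') (fun i => Zs i ω') ∂P)) atTop id
      (fun _ => P) (multivariateGaussian 0 (asymptoticCov K ℓ (∫ z, f x₀ z * φ z ^ 2))) := by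
  have : IsProbabilityMeasure (randomizedLaw x₀ ℓ f) :=
    (h_law 0).isProbabilityMeasure_iff.1 inferInstance
  have hh : Tendsto h atTop (𝓝[>] 0) := tendsto_nhdsWithin_iff.2 ⟨h_zero, .of_forall h_pos⟩
  obtain ⟨B, hB⟩ := exists_eventually_norm_rescaledScore_le hK hKc hℓ hℓ_zero
  have hcov : (asymptoticCov K ℓ (∫ z, f x₀ z * φ z ^ 2)).PosSemidef :=
    posSemidef_asymptoticCov hK hKc
      (integral_nonneg fun z => mul_nonneg (hf.nonneg x₀ z) (sq_nonneg _)) (hℓ0 0)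
  have hclt := tendstoInDistribution_smul_sum_sub_integral h_law h_indep
    (Y := fun N => summand K ℓ φ x₀ (h N))
    (fun N => (integrable_summand hf hK hKc hℓ hℓ0 hφ (h_pos N).ne').1.aemeasurable)
    ((h_zero.eventually hB).mono fun N hN => ae_norm_summand_le hφ hN)
    (tendsto_sqrt_mul_one_div h_pos h_zero h_rate (ℓ 0)) hcov fun t => ?_
  · refine hclt.congr (fun N => ae_of_all _ fun ω => ?_) .rfl
    dsimp only
    rw [integral_betaHat hf hK hKc hℓ hℓ0 hφ h_law (h_pos N).ne',
      betaHat_eq_smul_sum (h_pos N).ne', Finset.sum_sub_distrib, Finset.sum_const,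
      Finset.card_range, ← smul_sub, smul_smul]
  · have hvar := ((tendsto_variance_inner_summand (x₀ := x₀) hf hK hKc hℓ hℓ0 hφ hℓ_zero t).comp
      hh).const_mul (ℓ 0 ^ 2)⁻¹
    rw [dotProduct_asymptoticCov_mulVec hK hKc]
    convert hvar.congr' ?_ using 2
    · field_simp
    · filter_upwards [eventually_ne_atTop 0] with N hN
      rw [mul_sq_sqrt_mul_one_div (h_pos N) hN, mul_assoc, Function.comp_apply]

end AsymptoticNormality

section ParametricGradient

variable {E S : Type*} [NormedAddCommGroup E] [InnerProductSpace ℝ E]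

lemma norm_le_sum_abs_inner {ι : Type*} [Fintype ι] (b : OrthonormalBasis ι ℝ E) (x : E) :
    ‖x‖ ≤ ∑ i, |⟪x, b i⟫_ℝ| :=
  calc ‖x‖ = ‖∑ i, ⟪b i, x⟫_ℝ • b i‖ := by rw [b.sum_repr']
    _ ≤ ∑ i, ‖⟪b i, x⟫_ℝ • b i‖ := norm_sum_le _ _
    _ = ∑ i, |⟪x, b i⟫_ℝ| := by simp [norm_smul, real_inner_comm]

variable [CompleteSpace E]

lemma abs_inner_smul_gradient_le {u w : E → ℝ} {x v : E} {δ c C : ℝ} (hu : Differentiable ℝ u)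
    (hw : ∀ y ∈ Metric.ball x δ, |w y| ≤ c)
    (hC : ∀ y ∈ Metric.ball x δ, ‖w y • gradient u y - w x • gradient u x‖ ≤ C) (hv : ‖v‖ < δ) :
    |⟪w x • gradient u x, v⟫_ℝ| ≤ c * |u (x + v) - u x| + C * ‖v‖ := by
  have hmem : x + v ∈ Metric.ball x δ := by simpa using hv
  have hx : x ∈ Metric.ball x δ := Metric.mem_ball_self ((norm_nonneg v).trans_lt hv)
  obtain ⟨y, hy, hmvt⟩ := domain_mvt (fun y _ => (hu y).hasFDerivAt.hasFDerivWithinAt)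
    (convex_ball x δ) hx hmem
  replace hy := (convex_ball x δ).segment_subset hx hmem hy
  rw [add_sub_cancel_left, ← inner_gradient_left] at hmvt
  calc |⟪w x • gradient u x, v⟫_ℝ|
      = |w y * (u (x + v) - u x) - ⟪w y • gradient u y - w x • gradient u x, v⟫_ℝ| := by
        rw [hmvt, inner_sub_left, real_inner_smul_left _ v (w y), sub_sub_cancel]
    _ ≤ |w y| * |u (x + v) - u x| + ‖w y • gradient u y - w x • gradient u x‖ * ‖v‖ := by
        rw [← abs_mul]
        exact (abs_sub _ _).trans (by gcongr; exact abs_real_inner_le_norm _ _)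
    _ ≤ c * |u (x + v) - u x| + C * ‖v‖ := by
        gcongr
        exacts [hw y hy, hC y hy]

variable [FiniteDimensional ℝ E] [MeasurableSpace S] {ν : Measure S} {F : E → S → ℝ} {x₀ : E}

lemma aestronglyMeasurable_gradient (hF : ∀ x, AEStronglyMeasurable (F x) ν)
    (hFd : ∀ z, Differentiable ℝ fun x => F x z) (x : E) :
    AEStronglyMeasurable (fun z => gradient (fun y => F y z) x) ν := by
  set b := stdOrthonormalBasis ℝ E
  have hpartial (v : E) :
      AEStronglyMeasurable (fun z => ⟪v, gradient (fun y => F y z) x⟫_ℝ) ν := by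
    refine aestronglyMeasurable_of_tendsto_ae (u := atTop)
      (f := fun (k : ℕ) z => (k : ℝ) • (F (x + (k : ℝ)⁻¹ • v) z - F x z))
      (fun k => ((hF _).sub (hF _)).const_mul _) (ae_of_all _ fun z => ?_)
    rw [real_inner_comm, inner_gradient_left]
    exact ((hFd z x).hasFDerivAt.lim_real v).comp tendsto_natCast_atTop_atTop
  have hsum : AEStronglyMeasurable (fun z => ∑ i, ⟪b i, gradient (fun y => F y z) x⟫_ℝ • b i) ν :=
    Finset.aestronglyMeasurable_fun_sum _ fun i _ => (hpartial (b i)).smul_const _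
  simpa only [b.sum_repr'] using hsum

lemma hasGradientAt_integral_of_dominated {H : S → ℝ} {s : Set E} (hs : s ∈ 𝓝 x₀)
    (hF : ∀ x, Integrable (F x) ν) (hFd : ∀ z, Differentiable ℝ fun x => F x z)
    (hH : Integrable H ν) (hbound : ∀ x ∈ s, ∀ z, ‖gradient (fun y => F y z) x‖ ≤ H z) :
    HasGradientAt (fun x => ∫ z, F x z ∂ν) (∫ z, gradient (fun y => F y z) x₀ ∂ν) x₀ := by
  have hm := aestronglyMeasurable_gradient (fun x => (hF x).1) hFd x₀
  have hint : Integrable (fun z => gradient (fun y => F y z) x₀) ν :=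
    hH.mono' hm (ae_of_all _ (hbound x₀ (mem_of_mem_nhds hs)))
  have hdual (x : E) (z : S) : fderiv ℝ (fun y => F y z) x =
      innerSL ℝ (gradient (fun y => F y z) x) := by
    ext v
    rw [innerSL_apply_apply, inner_gradient_left]
  have hderiv := hasFDerivAt_integral_of_dominated_of_fderiv_le (𝕜 := ℝ) (μ := ν) hs
    (F := F) (F' := fun x z => fderiv ℝ (fun y => F y z) x) (x₀ := x₀)
    (.of_forall fun x => (hF x).1) (hF x₀)
    (by simp only [hdual]; exact (innerSL ℝ).continuous.comp_aestronglyMeasurable hm)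
    (ae_of_all _ fun z x hx => by rw [hdual, innerSL_apply_norm]; exact hbound x hx z)
    hH (ae_of_all _ fun z x _ => (hFd z x).hasFDerivAt)
  rw [hasGradientAt_iff_hasFDerivAt]
  refine hderiv.congr_fderiv ?_
  simp only [hdual, (innerSL ℝ).integral_comp_comm hint]
  rfl

variable {w : E → ℝ} {G : S → ℝ} {δ : ℝ}

lemma exists_integrable_norm_smul_gradient_le (hF : ∀ x, Integrable (F x) ν)
    (hFd : ∀ z, Differentiable ℝ fun x => F x z) (hw : ContinuousAt w x₀) (hG : Integrable G ν)
    (hδ : 0 < δ) (hosc : ∀ x ∈ Metric.ball x₀ δ, ∀ z,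
      ‖w x • gradient (fun y => F y z) x - w x₀ • gradient (fun y => F y z) x₀‖ ≤ G z) :
    ∃ H, Integrable H ν ∧ ∀ z, ‖w x₀ • gradient (fun y => F y z) x₀‖ ≤ H z := by
  obtain ⟨η, hη, hwη⟩ := Metric.eventually_nhds_iff_ball.1
    (hw.abs.eventually_lt_const (lt_add_one |w x₀|))
  set c := |w x₀| + 1
  set ρ := min δ η / 2
  have hρ : 0 < ρ := by positivity
  have hρδ : ρ < min δ η := half_lt_self (lt_min hδ hη)
  set b := stdOrthonormalBasis ℝ E
  refine ⟨fun z => ∑ j, ρ⁻¹ * (c * |F (x₀ + ρ • b j) z - F x₀ z| + G z * ρ),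
    integrable_finsetSum _ fun j _ => ((((hF _).sub (hF _)).abs.const_mul c).add
      (hG.mul_const ρ)).const_mul ρ⁻¹, fun z => (norm_le_sum_abs_inner b _).trans ?_⟩
  refine Finset.sum_le_sum fun j _ => (le_inv_mul_iff₀ hρ).2 ?_
  have hnorm : ‖ρ • b j‖ = ρ := by simp [norm_smul, abs_of_pos hρ]
  have hle := abs_inner_smul_gradient_le (x := x₀) (v := ρ • b j) (δ := min δ η) (hFd z)
    (fun y hy => (hwη y (Metric.ball_subset_ball (min_le_right _ _) hy)).le)
    (fun y hy => hosc y (Metric.ball_subset_ball (min_le_left _ _) hy) z) (by rwa [hnorm])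
  rwa [real_inner_smul_right, abs_mul, abs_of_pos hρ, hnorm] at hle

lemma exists_integrable_eventually_norm_gradient_le (hF : ∀ x, Integrable (F x) ν)
    (hFd : ∀ z, Differentiable ℝ fun x => F x z) (hw : ContinuousAt w x₀) (hw0 : w x₀ ≠ 0)
    (hG : Integrable G ν) (hδ : 0 < δ) (hosc : ∀ x ∈ Metric.ball x₀ δ, ∀ z,
      ‖w x • gradient (fun y => F y z) x - w x₀ • gradient (fun y => F y z) x₀‖ ≤ G z) :
    ∃ H, Integrable H ν ∧ ∀ᶠ x in 𝓝 x₀, ∀ z, ‖gradient (fun y => F y z) x‖ ≤ H z := by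
  obtain ⟨H, hH, hHle⟩ := exists_integrable_norm_smul_gradient_le hF hFd hw hG hδ hosc
  have hpos : 0 < |w x₀| := abs_pos.2 hw0
  refine ⟨fun z => (|w x₀| / 2)⁻¹ * (H z + G z), (hH.add hG).const_mul _, ?_⟩
  filter_upwards [Metric.ball_mem_nhds x₀ hδ,
    hw.abs.eventually_const_lt (half_lt_self hpos)] with x hx hwx z
  refine (le_inv_mul_iff₀ (by positivity)).2 ?_
  calc |w x₀| / 2 * ‖gradient (fun y => F y z) x‖
      ≤ |w x| * ‖gradient (fun y => F y z) x‖ := by gcongr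
    _ = ‖w x • gradient (fun y => F y z) x‖ := by rw [norm_smul, Real.norm_eq_abs]
    _ ≤ ‖w x₀ • gradient (fun y => F y z) x₀‖ +
          ‖w x • gradient (fun y => F y z) x - w x₀ • gradient (fun y => F y z) x₀‖ :=
        norm_le_norm_add_norm_sub' _ _
    _ ≤ H z + G z := add_le_add (hHle z) (hosc x hx z)

/-- A weighted oscillation bound on the gradients is enough to differentiate under the integral:
difference quotients bound the gradient at `x₀` itself. -/
lemma hasGradientAt_integral_of_oscillation (hF : ∀ x, Integrable (F x) ν)
    (hFd : ∀ z, Differentiable ℝ fun x => F x z) (hw : ContinuousAt w x₀) (hw0 : w x₀ ≠ 0)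
    (hG : Integrable G ν) (hδ : 0 < δ) (hosc : ∀ x ∈ Metric.ball x₀ δ, ∀ z,
      ‖w x • gradient (fun y => F y z) x - w x₀ • gradient (fun y => F y z) x₀‖ ≤ G z) :
    Integrable (fun z => gradient (fun y => F y z) x₀) ν ∧
      HasGradientAt (fun x => ∫ z, F x z ∂ν) (∫ z, gradient (fun y => F y z) x₀ ∂ν) x₀ := by
  obtain ⟨H, hH, hHle⟩ := exists_integrable_eventually_norm_gradient_le hF hFd hw hw0 hG hδ hosc
  exact ⟨hH.mono' (aestronglyMeasurable_gradient (fun x => (hF x).1) hFd x₀)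
    (ae_of_all _ hHle.self_of_nhds),
    hasGradientAt_integral_of_dominated hHle hF hFd hH fun x hx => hx⟩

end ParametricGradient

section ScoreIntegral

variable {E : Type*} [NormedAddCommGroup E] [InnerProductSpace ℝ E] [CompleteSpace E]
  {K ℓ u : E → ℝ}

lemma gradient_mul_const {x : E} (hu : DifferentiableAt ℝ u x) (c : ℝ) :
    gradient (fun y => u y * c) x = c • gradient u x := by
  rw [gradient, fderiv_mul_const hu, gradient, map_smulₛₗ, conj_trivial]

lemma gradient_comp_sub_smul_mul_comp_smul {a l : E} {h : ℝ}
    (hu : DifferentiableAt ℝ u (a - h • l)) (hℓ : DifferentiableAt ℝ ℓ (h • l)) :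
    gradient (fun y => u (a - h • y) * ℓ (h • y)) l =
      h • (u (a - h • l) • gradient ℓ (h • l) - ℓ (h • l) • gradient u (a - h • l)) := by
  have hline : HasFDerivAt (fun y : E => h • y) (h • ContinuousLinearMap.id ℝ E) l :=
    (hasFDerivAt_id l).const_smul h
  have hprod := (hu.hasFDerivAt.comp l (hline.const_sub a)).mul (hℓ.hasFDerivAt.comp l hline)
  refine HasGradientAt.gradient (hasGradientAt_iff_hasFDerivAt.2 (hprod.congr_fderiv ?_))
  ext v
  simp
  ring

variable [FiniteDimensional ℝ E] [MeasurableSpace E] [BorelSpace E] {μ : Measure E}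
  [μ.IsAddHaarMeasure]

lemma integral_smul_rescaledScore (hK : ContDiff ℝ 1 K) (hKc : HasCompactSupport K)
    (hℓ : ContDiff ℝ 1 ℓ) (hℓ0 : ∀ x, 0 ≤ ℓ x) (hu : ContDiff ℝ 1 u) (a : E) (h : ℝ) :
    ∫ l, u (a - h • l) • ℓ (h • l) • rescaledScore K ℓ h l ∂μ =
      h • ∫ l, K l • ℓ (h • l) • gradient u (a - h • l) ∂μ := by
  have hKcont := hK.continuous
  have hK' := continuous_gradient hK
  have hℓcont := hℓ.continuous
  have hℓ' := continuous_gradient hℓ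
  have hucont := hu.continuous
  have hu' := continuous_gradient hu
  have hv : ContDiff ℝ 1 fun l => u (a - h • l) * ℓ (h • l) := by fun_prop
  have hint {W : E → E} (hW : Continuous W) : Integrable (fun l => K l • W l) μ :=
    (hKcont.smul hW).integrable_of_hasCompactSupport hKc.smul_right
  have hintK : Integrable (fun l => (u (a - h • l) * ℓ (h • l)) • gradient K l) μ :=
    (hv.continuous.smul hK').integrable_of_hasCompactSupport
      (hasCompactSupport_gradient hKc).smul_left
  have hparts := integral_smul_gradient_eq_neg (μ := μ) hK hKc hv
  simp only [gradient_comp_sub_smul_mul_comp_smul (hu.differentiable one_ne_zero _)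
    (hℓ.differentiable one_ne_zero _)] at hparts
  calc ∫ l, u (a - h • l) • ℓ (h • l) • rescaledScore K ℓ h l ∂μ
      = ∫ l, (u (a - h • l) * ℓ (h • l)) • gradient K l +
          K l • h • u (a - h • l) • gradient ℓ (h • l) ∂μ := by
        simp_rw [smul_rescaledScore hℓ0]
        congr with l
        module
    _ = ∫ l, K l • h • u (a - h • l) • gradient ℓ (h • l) ∂μ -
          ∫ l, K l • h • (u (a - h • l) • gradient ℓ (h • l) -
            ℓ (h • l) • gradient u (a - h • l)) ∂μ := by
        rw [integral_add hintK (hint (by fun_prop)), hparts, neg_add_eq_sub]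
    _ = h • ∫ l, K l • ℓ (h • l) • gradient u (a - h • l) ∂μ := by
        rw [← integral_sub (hint (by fun_prop)) (hint (by fun_prop)), ← integral_smul]
        congr with l
        module

end ScoreIntegral

section Bias

variable {d n p : ℕ} {K ℓ : EuclideanSpace ℝ (Fin d) → ℝ}
  {f : EuclideanSpace ℝ (Fin d) → EuclideanSpace ℝ (Fin n) → ℝ}
  {φ : EuclideanSpace ℝ (Fin n) → ℝ} {x₀ : EuclideanSpace ℝ (Fin d)}

lemma iterDifferentiable_weightedGradient {z : EuclideanSpace ℝ (Fin n)}
    (hℓ : DifferentiableTimes (p + 1) ℓ) (hf : DifferentiableTimes (p + 1) fun x => f x z) :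
    IterDifferentiable p (weightedGradient x₀ ℓ f z) := by
  have hgrad : IterDifferentiable p (gradient fun x => f x z) :=
    (IterDifferentiable.succ_iff.1 hf).2.clm_comp
      (InnerProductSpace.toDual ℝ _).symm.toContinuousLinearEquiv.toContinuousLinearMap
  exact ((IterDifferentiable.mono hℓ p.le_succ).comp_const_sub x₀).bilinear hgrad
    (ContinuousLinearMap.lsmul ℝ ℝ)

lemma DominatedOscillation.hasGradientAt_integral (hosc : DominatedOscillation p x₀ ℓ f φ)
    (hfφ : ∀ x, Integrable fun z => f x z * φ z) (hfd : ∀ z, Differentiable ℝ fun x => f x z)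
    (hℓ : Continuous ℓ) (hℓ_zero : ℓ 0 ≠ 0) :
    Integrable (fun z => φ z • weightedGradient x₀ ℓ f z x₀) ∧
      HasGradientAt (fun x => ∫ z, f x z * φ z)
        ((ℓ 0)⁻¹ • ∫ z, φ z • weightedGradient x₀ ℓ f z x₀) x₀ := by
  obtain ⟨G, hG, δ, hδ, hle⟩ := hosc
  have hgrad (x : EuclideanSpace ℝ (Fin d)) (z : EuclideanSpace ℝ (Fin n)) :
      gradient (fun y => f y z * φ z) x = φ z • gradient (fun y => f y z) x :=
    gradient_mul_const (hfd z x) (φ z)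
  have hweight (x : EuclideanSpace ℝ (Fin d)) (z : EuclideanSpace ℝ (Fin n)) :
      ℓ (x₀ - x) • φ z • gradient (fun y => f y z) x = φ z • weightedGradient x₀ ℓ f z x :=
    smul_comm _ _ _
  have hzero (x : EuclideanSpace ℝ (Fin d)) (hx : x ∈ Metric.ball x₀ δ)
      (z : EuclideanSpace ℝ (Fin n)) : ‖ℓ (x₀ - x) • gradient (fun y => f y z * φ z) x -
        ℓ (x₀ - x₀) • gradient (fun y => f y z * φ z) x₀‖ ≤ G z := by
    have := hle 0 p.zero_le x hx z
    rw [iteratedFDeriv_zero_eq_comp] at this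
    simpa only [hgrad, hweight, ← smul_sub, norm_smul, Real.norm_eq_abs, Function.comp_apply,
      ← map_sub, LinearIsometryEquiv.norm_map] using this
  obtain ⟨hint, hder⟩ := hasGradientAt_integral_of_oscillation (w := fun x => ℓ (x₀ - x)) hfφ
    (fun z => (hfd z).mul_const (φ z)) (by fun_prop) (by simpa using hℓ_zero) hG hδ hzero
  have hx₀ (z : EuclideanSpace ℝ (Fin n)) : φ z • weightedGradient x₀ ℓ f z x₀ =
      ℓ 0 • gradient (fun y => f y z * φ z) x₀ := by
    rw [hgrad, ← hweight, sub_self]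
  simp only [hx₀, integral_smul, inv_smul_smul₀ hℓ_zero]
  exact ⟨hint.smul (ℓ 0), hder⟩

/-- The mollification at `x₀`, at scale `h`, of `x ↦ ℓ(x₀ - x) ∇ₓ f(x, z)`. Integrated against
`φ` it is, up to the factor `ℓ(0)`, the mean of the estimator. -/
def smoothedGradient (K : EuclideanSpace ℝ (Fin d) → ℝ) (x₀ : EuclideanSpace ℝ (Fin d))
    (ℓ : EuclideanSpace ℝ (Fin d) → ℝ)
    (f : EuclideanSpace ℝ (Fin d) → EuclideanSpace ℝ (Fin n) → ℝ) (h : ℝ)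
    (z : EuclideanSpace ℝ (Fin n)) : EuclideanSpace ℝ (Fin d) :=
  ∫ l, K l • weightedGradient x₀ ℓ f z (x₀ - h • l)

lemma DominatedOscillation.exists_norm_smoothedGradient_sub_le
    (hosc : DominatedOscillation p x₀ ℓ f φ) (hp : p ≠ 0) (hK : Continuous K)
    (hKc : HasCompactSupport K) (hK1 : ∫ l, K l = 1)
    (hmom : ∀ r, 0 < r → r < p → ∀ α : Fin r → Fin d, kernelMoment K α = 0)
    (hℓ : DifferentiableTimes (p + 1) ℓ)
    (hf : ∀ z, DifferentiableTimes (p + 1) fun x => f x z) :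
    ∃ G : EuclideanSpace ℝ (Fin n) → ℝ, Integrable G ∧ ∀ᶠ h in 𝓝[>] (0 : ℝ), ∀ z,
      ‖φ z • (smoothedGradient K x₀ ℓ f h z - weightedGradient x₀ ℓ f z x₀)‖ ≤ G z * h ^ p := by
  obtain ⟨G, hG, δ, hδ, hle⟩ := hosc
  obtain ⟨R, hR_pos, hR⟩ := hKc.isCompact.isBounded.exists_pos_norm_le
  have hhR : ∀ᶠ h in 𝓝[>] (0 : ℝ), h * R < δ :=
    ((continuous_mul_const R).tendsto' 0 0 (zero_mul R)).eventually_lt_const hδ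
      |>.filter_mono nhdsWithin_le_nhds
  refine ⟨fun z => (∫ l, |K l|) * (2 * (1 + δ⁻¹)) * R ^ p / p.factorial * G z, hG.const_mul _, ?_⟩
  filter_upwards [self_mem_nhdsWithin, hhR] with h (hh : 0 < h) hhR z
  rw [norm_smul, Real.norm_eq_abs]
  rcases eq_or_ne (φ z) 0 with hφz | hφz
  · have hG0 : 0 ≤ G z := by simpa using hle 0 p.zero_le x₀ (Metric.mem_ball_self hδ) z
    rw [hφz, abs_zero, zero_mul]
    positivity
  have hφ_pos : 0 < |φ z| := abs_pos.2 hφz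
  have hder : ∀ y ∈ Metric.ball x₀ δ,
      ‖iteratedFDeriv ℝ p (weightedGradient x₀ ℓ f z) y‖ ≤ 2 * (1 + δ⁻¹) * (G z / |φ z|) := by
    obtain ⟨q, rfl⟩ := Nat.exists_eq_succ_of_ne_zero hp
    intro y hy
    have hw := iterDifferentiable_weightedGradient (x₀ := x₀) hℓ (hf z)
    refine hw.norm_iteratedFDeriv_succ_le_of_oscillation (fun y hy => ?_) (fun y hy => ?_) hy
    · exact (le_div_iff₀' hφ_pos).2 (hle q q.le_succ y hy z)
    · exact (le_div_iff₀' hφ_pos).2 (hle (q + 1) le_rfl y hy z)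
  have hbias := norm_integral_smul_sub_le hK hKc hK1 hp hmom
    (fun l hl => hR l (subset_tsupport K hl)) (iterDifferentiable_weightedGradient hℓ (hf z))
    hh.le hhR hder
  refine (mul_le_mul_of_nonneg_left hbias hφ_pos.le).trans_eq ?_
  rw [mul_pow]
  field_simp

lemma integral_density_smul_rescaledScore (hK : ContDiff ℝ 1 K) (hKc : HasCompactSupport K)
    (hℓ : ContDiff ℝ 1 ℓ) (hℓ0 : ∀ x, 0 ≤ ℓ x) {z : EuclideanSpace ℝ (Fin n)}
    (hf : ContDiff ℝ 1 fun x => f x z) {h : ℝ} (hh : 0 < h) :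
    ∫ x, (f x z * φ z) • (fun l => ℓ (h • l) • rescaledScore K ℓ h l) (h⁻¹ • (x₀ - x)) =
      h ^ (d + 1) • φ z • smoothedGradient K x₀ ℓ f h z := by
  have hrescale := integral_comp_rescale
    (fun l => φ z • f (x₀ - h • l) z • ℓ (h • l) • rescaledScore K ℓ h l) x₀ hh
  simp only [smul_inv_smul₀ hh.ne', sub_sub_cancel] at hrescale
  simp only [smul_inv_smul₀ hh.ne', mul_comm _ (φ z), mul_smul]
  rw [hrescale, integral_smul, integral_smul_rescaledScore hK hKc hℓ hℓ0 hf, pow_succ, mul_smul,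
    smul_comm h]
  simp only [smoothedGradient, weightedGradient, sub_sub_cancel]

lemma integral_summand (hf : IsDensityFamily volume f) (hK : ContDiff ℝ 1 K)
    (hKc : HasCompactSupport K) (hℓ : ContDiff ℝ 1 ℓ) (hℓ0 : ∀ x, 0 ≤ ℓ x)
    (hφ : MemLp φ ⊤ volume) (hfd : ∀ z, ContDiff ℝ 1 fun x => f x z) {h : ℝ} (hh : 0 < h) :
    Integrable (fun z => φ z • smoothedGradient K x₀ ℓ f h z) ∧
      ∫ q, summand K ℓ φ x₀ h q ∂randomizedLaw x₀ ℓ f =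
        h ^ (d + 1) • ∫ z, φ z • smoothedGradient K x₀ ℓ f h z := by
  have hint := hf.integrable_prod_smul hφ
    (integrable_comp_rescale (integrable_smul_rescaledScore hK hKc hℓ hℓ0 h) x₀ hh.ne')
  have hfiber (z : EuclideanSpace ℝ (Fin n)) := integral_density_smul_rescaledScore (φ := φ)
    (x₀ := x₀) hK hKc hℓ hℓ0 (hfd z) hh
  constructor
  · have hright := hint.integral_prod_right
    simp only [hfiber] at hright
    exact (integrable_smul_iff (pow_pos hh (d + 1)).ne' _).1 hright
  · simp only [summand]
    rw [integral_randomizedLaw hf.measurable_uncurry hf.nonneg hℓ.continuous.measurable hℓ0]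
    simp only [randomizedLaw_density_smul_rescaled hh.ne']
    rw [Measure.volume_eq_prod, integral_prod_symm _ hint]
    simp only [hfiber, integral_smul]

variable {Ω : Type*} [MeasurableSpace Ω] {P : Measure Ω}
  {Λ : ℕ → Ω → EuclideanSpace ℝ (Fin d)} {Zs : ℕ → Ω → EuclideanSpace ℝ (Fin n)}

lemma integral_betaHat_eq_smul_integral_smoothedGradient (hf : IsDensityFamily volume f)
    (hK : ContDiff ℝ 1 K) (hKc : HasCompactSupport K) (hℓ : ContDiff ℝ 1 ℓ) (hℓ0 : ∀ x, 0 ≤ ℓ x)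
    (hφ : MemLp φ ⊤ volume) (hfd : ∀ z, ContDiff ℝ 1 fun x => f x z)
    (h_law : ∀ i, HasLaw (fun ω => (Λ i ω, Zs i ω)) (randomizedLaw x₀ ℓ f) P)
    {h : ℝ} (hh : 0 < h) {N : ℕ} (hN : N ≠ 0) :
    ∫ ω, betaHat K ℓ φ x₀ N h (fun i => Λ i ω) (fun i => Zs i ω) ∂P =
      (ℓ 0)⁻¹ • ∫ z, φ z • smoothedGradient K x₀ ℓ f h z := by
  rw [integral_betaHat hf hK hKc hℓ hℓ0 hφ h_law hh.ne',
    (integral_summand hf hK hKc hℓ hℓ0 hφ hfd hh).2, ← Nat.cast_smul_eq_nsmul ℝ, smul_smul,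
    smul_smul]
  congr 1
  have hN' : (N : ℝ) ≠ 0 := Nat.cast_ne_zero.2 hN
  field_simp

lemma DominatedOscillation.exists_norm_integral_betaHat_sub_le
    (hosc : DominatedOscillation p x₀ ℓ f φ) (hp : p ≠ 0) (hf : IsDensityFamily volume f)
    (hK : ContDiff ℝ 1 K) (hKc : HasCompactSupport K) (hK1 : ∫ l, K l = 1)
    (hmom : ∀ r, 0 < r → r < p → ∀ α : Fin r → Fin d, kernelMoment K α = 0)
    (hℓ : DifferentiableTimes (p + 1) ℓ) (hℓ0 : ∀ x, 0 ≤ ℓ x) (hℓ_zero : ℓ 0 ≠ 0)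
    (hfd : ∀ z, DifferentiableTimes (p + 1) fun x => f x z) (hφ : MemLp φ ⊤ volume)
    (h_law : ∀ i, HasLaw (fun ω => (Λ i ω, Zs i ω)) (randomizedLaw x₀ ℓ f) P) :
    ∃ C, ∀ᶠ h in 𝓝[>] (0 : ℝ), ∀ N ≠ 0,
      ‖(∫ ω, betaHat K ℓ φ x₀ N h (fun i => Λ i ω) (fun i => Zs i ω) ∂P) -
        gradient (fun x => ∫ z, f x z * φ z) x₀‖ ≤ C * h ^ p := by
  have hℓ1 : ContDiff ℝ 1 ℓ := IterDifferentiable.contDiff_one hℓ hp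
  have hf1 (z : EuclideanSpace ℝ (Fin n)) : ContDiff ℝ 1 fun x => f x z :=
    IterDifferentiable.contDiff_one (hfd z) hp
  obtain ⟨hint, hgrad⟩ := hosc.hasGradientAt_integral (hf.integrable_mul hφ)
    (fun z => (hf1 z).differentiable one_ne_zero) hℓ1.continuous hℓ_zero
  obtain ⟨G, hG, hle⟩ := hosc.exists_norm_smoothedGradient_sub_le hp hK.continuous hKc hK1 hmom hℓ
    hfd
  refine ⟨|(ℓ 0)⁻¹| * ∫ z, G z, ?_⟩
  filter_upwards [self_mem_nhdsWithin, hle] with h (hh : 0 < h) hle N hN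
  rw [integral_betaHat_eq_smul_integral_smoothedGradient hf hK hKc hℓ1 hℓ0 hφ hf1 h_law hh hN,
    hgrad.gradient, ← smul_sub,
    ← integral_sub (integral_summand hf hK hKc hℓ1 hℓ0 hφ hf1 hh).1 hint, norm_smul, mul_assoc,
    ← integral_mul_const, Real.norm_eq_abs]
  simp_rw [← smul_sub]
  gcongr
  exact norm_integral_le_of_norm_le (hG.mul_const _) (ae_of_all _ hle)

end Bias

section Law

variable {X S Ω : Type*} [MeasurableSpace S] {ν : Measure S} [MeasurableSpace Ω] {P : Measure Ω}

lemma isDensityFamily_of_hasLaw [TopologicalSpace X] [IsProbabilityMeasure P] {f : X → S → ℝ}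
    (hc : ∀ z, Continuous fun x => f x z) (hm : ∀ x, Measurable (f x)) (h0 : ∀ x z, 0 ≤ f x z)
    {Z : X → Ω → S} (hZ : ∀ x, HasLaw (Z x) (ν.withDensity fun z => ENNReal.ofReal (f x z)) P) :
    IsDensityFamily ν f := by
  refine ⟨hc, hm, h0, fun x => ?_⟩
  have hP : IsProbabilityMeasure (ν.withDensity fun z => ENNReal.ofReal (f x z)) :=
    (hZ x).isProbabilityMeasure_iff.1 inferInstance
  rw [integral_eq_lintegral_of_nonneg_ae (ae_of_all _ (h0 x)) (hm x).aestronglyMeasurable,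
    ← setLIntegral_univ, ← withDensity_apply _ .univ, measure_univ, ENNReal.toReal_one]

lemma integral_comp_hasLaw {u : S → ℝ} (hu : Measurable u) (h0 : ∀ z, 0 ≤ u z) {Z : Ω → S}
    (hZ : HasLaw Z (ν.withDensity fun z => ENNReal.ofReal (u z)) P)
    {φ : S → ℝ} (hφ : AEStronglyMeasurable φ ν) :
    ∫ ω, φ (Z ω) ∂P = ∫ z, u z * φ z ∂ν := by
  have hlaw := hZ.integral_comp (hφ.mono_ac (withDensity_absolutelyContinuous _ _))
  rw [integral_withDensity_eq_integral_toReal_smul hu.ennreal_ofReal (by simp)] at hlaw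
  simpa only [Function.comp_def, ENNReal.toReal_ofReal (h0 _), smul_eq_mul] using hlaw

end Law

section Bandwidth

variable {E : Type*} [NormedAddCommGroup E] {b : ℕ → E} {C : ℝ} {h : ℕ → ℝ} {p : ℕ}

lemma tendsto_zero_of_norm_le_mul_pow (hb : ∀ᶠ N in atTop, ‖b N‖ ≤ C * h N ^ p) (hp : p ≠ 0)
    (h_zero : Tendsto h atTop (𝓝 0)) : Tendsto b atTop (𝓝 0) := by
  refine squeeze_zero_norm' hb ?_
  simpa only [zero_pow hp, mul_zero] using (h_zero.pow p).const_mul C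

lemma tendsto_sqrt_smul_zero_of_norm_le_mul_pow [NormedSpace ℝ E]
    (hb : ∀ᶠ N in atTop, ‖b N‖ ≤ C * h N ^ p) (h_pos : ∀ N, 0 < h N) {k : ℕ}
    (h_rate : Tendsto (fun N : ℕ => N * h N ^ (k + 2 * p)) atTop (𝓝 0)) :
    Tendsto (fun N : ℕ => √(N * h N ^ k) • b N) atTop (𝓝 0) := by
  have hlim : Tendsto (fun N : ℕ => C * √(N * h N ^ (k + 2 * p))) atTop (𝓝 0) := by
    simpa only [Real.sqrt_zero, mul_zero] using h_rate.sqrt.const_mul C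
  refine squeeze_zero_norm' ?_ hlim
  filter_upwards [hb] with N hN
  have hsq : √(N * h N ^ (k + 2 * p)) = √(N * h N ^ k) * h N ^ p := by
    rw [pow_add, ← mul_assoc, mul_comm 2 p, pow_mul, Real.sqrt_mul' _ (sq_nonneg _),
      Real.sqrt_sq (pow_nonneg (h_pos N).le p)]
  rw [norm_smul, Real.norm_of_nonneg (Real.sqrt_nonneg _), hsq, mul_left_comm]
  gcongr

end Bandwidth

section Recentering

variable {E Ω Ω' : Type*} [NormedAddCommGroup E] [NormedSpace ℝ E] [MeasurableSpace E]
  [BorelSpace E] [SecondCountableTopology E] [MeasurableSpace Ω] [MeasurableSpace Ω']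
  {P : Measure Ω} [IsProbabilityMeasure P] {Q : Measure Ω'} [IsProbabilityMeasure Q]

lemma tendstoInDistribution_smul_sub_of_tendsto {X : ℕ → Ω → E} {Y : Ω' → E} {a : ℕ → ℝ}
    {m : ℕ → E} {c : E}
    (hX : TendstoInDistribution (fun N ω => a N • (X N ω - m N)) atTop Y (fun _ => P) Q)
    (hm : Tendsto (fun N => a N • (m N - c)) atTop (𝓝 0)) :
    TendstoInDistribution (fun N ω => a N • (X N ω - c)) atTop Y (fun _ => P) Q := by
  have hsum := hX.add_of_tendstoInMeasure_const (Y := fun N _ => a N • (m N - c))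
    (tendstoInMeasure_of_tendsto_ae (fun _ => aestronglyMeasurable_const) (ae_of_all _ fun _ => hm))
    fun _ => aemeasurable_const
  refine hsum.congr (fun N => ae_of_all _ fun ω => ?_) (ae_of_all _ fun ω => add_zero (Y ω))
  simp only [Pi.add_apply, ← smul_add, sub_add_sub_cancel]

end Recentering

end KernelGreeks

end

open KernelGreeks in
theorem theorem4p1_general {d n : ℕ} {Ω : Type*} [MeasurableSpace Ω] (P : Measure Ω)
    [IsProbabilityMeasure P] (x₀ : EuclideanSpace ℝ (Fin d))
    (f : EuclideanSpace ℝ (Fin d) → EuclideanSpace ℝ (Fin n) → ℝ)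
    (hf_meas : ∀ x, Measurable (f x)) (hf_nonneg : ∀ x z, 0 ≤ f x z)
    (hf_cont : ∀ z, Continuous fun x => f x z)
    (Z : EuclideanSpace ℝ (Fin d) → Ω → EuclideanSpace ℝ (Fin n))
    (hZ : ∀ x, HasLaw (Z x) (volume.withDensity fun z => ENNReal.ofReal (f x z)) P)
    (ℓ : EuclideanSpace ℝ (Fin d) → ℝ) (hℓ : ContDiff ℝ 1 ℓ)
    (hℓ_nonneg : ∀ x, 0 ≤ ℓ x) (hℓ_zero : ℓ 0 ≠ 0)
    (Λ : ℕ → Ω → EuclideanSpace ℝ (Fin d)) (Zs : ℕ → Ω → EuclideanSpace ℝ (Fin n))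
    (h_law : ∀ i, HasLaw (fun ω => (Λ i ω, Zs i ω)) (randomizedLaw x₀ ℓ f) P)
    (h_indep : iIndepFun (fun i ω => (Λ i ω, Zs i ω)) P)
    (φ : EuclideanSpace ℝ (Fin n) → ℝ) (hφ : MemLp φ ⊤ volume)
    (K : EuclideanSpace ℝ (Fin d) → ℝ) (hK : ContDiff ℝ 1 K) (hKc : HasCompactSupport K)
    (h : ℕ → ℝ) (h_pos : ∀ N, 0 < h N) (h_zero : Tendsto h atTop (𝓝 0))
    (h_rate : Tendsto (fun N : ℕ => (N : ℝ) * h N ^ (d + 2)) atTop atTop) :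
    let betaN : ℕ → Ω → EuclideanSpace ℝ (Fin d) := fun N ω =>
      betaHat K ℓ φ x₀ N (h N) (fun i => Λ i ω) (fun i => Zs i ω)
    let V : EuclideanSpace ℝ (Fin d) → ℝ := fun x => ∫ ω, φ (Z x ω) ∂P
    let β : EuclideanSpace ℝ (Fin d) := gradient V x₀
    let cov : Matrix (Fin d) (Fin d) ℝ := asymptoticCov K ℓ (∫ ω, φ (Z x₀ ω) ^ 2 ∂P)
    let rate : ℕ → ℝ := fun N => √((N : ℝ) * h N ^ (d + 2))
    ((∀ N, Integrable (betaN N) P) ∧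
      TendstoInDistribution (fun N ω => rate N • (betaN N ω - ∫ ω', betaN N ω' ∂P)) atTop id
        (fun _ => P) (multivariateGaussian 0 cov)) ∧
    (∀ p ≠ 0, DifferentiableTimes (p + 1) ℓ → (∀ z, DifferentiableTimes (p + 1) fun x => f x z) →
      ∫ l, K l = 1 → (∀ r, 0 < r → r < p → ∀ α : Fin r → Fin d, kernelMoment K α = 0) →
      DominatedOscillation p x₀ ℓ f φ →
      Tendsto (fun N : ℕ => (N : ℝ) * h N ^ (d + 2 + 2 * p)) atTop (𝓝 0) →
      DifferentiableAt ℝ V x₀ ∧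
      Tendsto (fun N => (∫ ω, betaN N ω ∂P) - β) atTop (𝓝 0) ∧
      Tendsto (fun N => rate N • ((∫ ω, betaN N ω ∂P) - β)) atTop (𝓝 0) ∧
      TendstoInDistribution (fun N ω => rate N • (betaN N ω - β)) atTop id
        (fun _ => P) (multivariateGaussian 0 cov)) := by
  intro betaN V β cov rate
  have hf := isDensityFamily_of_hasLaw hf_cont hf_meas hf_nonneg hZ
  have hV : V = fun x => ∫ z, f x z * φ z :=
    funext fun x => integral_comp_hasLaw (hf_meas x) (hf_nonneg x) (hZ x) hφ.1
  have hφ_sq : ∫ ω, φ (Z x₀ ω) ^ 2 ∂P = ∫ z, f x₀ z * φ z ^ 2 :=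
    integral_comp_hasLaw (φ := fun z => φ z ^ 2) (hf_meas x₀) (hf_nonneg x₀) (hZ x₀) (hφ.1.pow 2)
  have hclt := tendstoInDistribution_betaHat_sub_integral hf hK hKc hℓ hℓ_nonneg hφ h_law hℓ_zero
    h_indep h_pos h_zero h_rate
  rw [← hφ_sq] at hclt
  refine ⟨⟨fun N => integrable_betaHat hf hK hKc hℓ hℓ_nonneg hφ h_law (h_pos N).ne' N, hclt⟩,
    fun p hp hℓp hfp hK1 hmom hosc hrate => ?_⟩
  have hV_diff : DifferentiableAt ℝ V x₀ := hV ▸ (hosc.hasGradientAt_integral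
    (hf.integrable_mul hφ) (fun z => (IterDifferentiable.succ_iff.1 (hfp z)).1) hℓ.continuous
    hℓ_zero).2.differentiableAt
  obtain ⟨C, hC⟩ := hosc.exists_norm_integral_betaHat_sub_le hp hf hK hKc hK1 hmom hℓp hℓ_nonneg
    hℓ_zero hfp hφ h_law
  have hbias : ∀ᶠ N in atTop, ‖(∫ ω, betaN N ω ∂P) - β‖ ≤ C * h N ^ p := by
    have hh : Tendsto h atTop (𝓝[>] 0) := tendsto_nhdsWithin_iff.2 ⟨h_zero, .of_forall h_pos⟩
    filter_upwards [hh.eventually hC, eventually_ne_atTop 0] with N hN hN0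
    simpa only [β, hV] using hN N hN0
  have hscaled := tendsto_sqrt_smul_zero_of_norm_le_mul_pow hbias h_pos hrate
  exact ⟨hV_diff, tendsto_zero_of_norm_le_mul_pow hbias hp h_zero, hscaled,
    tendstoInDistribution_smul_sub_of_tendsto hclt hscaled⟩

theorem theorem4p1 {d n p : ℕ} {Ω : Type*} [MeasurableSpace Ω] (P : Measure Ω)
    [IsProbabilityMeasure P]
    (x₀ : EuclideanSpace ℝ (Fin d))
    -- the densities `f(x, ·)` of the random vectors `Z(x)`
    (f : EuclideanSpace ℝ (Fin d) → EuclideanSpace ℝ (Fin n) → ℝ)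
    (hf_meas : ∀ x, Measurable (f x)) (hf_nonneg : ∀ x z, 0 ≤ f x z)
    (Z : EuclideanSpace ℝ (Fin d) → Ω → EuclideanSpace ℝ (Fin n))
    (hZ : ∀ x, HasLaw (Z x) (volume.withDensity fun z => ENNReal.ofReal (f x z)) P)
    -- the randomizing density
    (ℓ : EuclideanSpace ℝ (Fin d) → ℝ)
    (hℓ_nonneg : ∀ x, 0 ≤ ℓ x) (hℓ_int : ∫ x, ℓ x = 1) (hℓ_zero : 0 < ℓ 0)
    -- the i.i.d. sample
    (Λ : ℕ → Ω → EuclideanSpace ℝ (Fin d)) (Zs : ℕ → Ω → EuclideanSpace ℝ (Fin n))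
    (h_law : ∀ i, HasLaw (fun ω => (Λ i ω, Zs i ω)) (KernelGreeks.randomizedLaw x₀ ℓ f) P)
    (h_indep : iIndepFun (fun i ω => (Λ i ω, Zs i ω)) P)
    -- the bounded payoff and the kernel
    (φ : EuclideanSpace ℝ (Fin n) → ℝ) (hφ : MemLp φ ⊤ volume)
    (K : EuclideanSpace ℝ (Fin d) → ℝ) (hK : KernelGreeks.AssumptionK K p)
    (hR1 : KernelGreeks.AssumptionR1 p x₀ ℓ f φ)
    -- the bandwidths
    (h : ℕ → ℝ) (h_pos : ∀ N, 0 < h N) (h_zero : Tendsto h atTop (𝓝 0))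
    (h_rate : Tendsto (fun N : ℕ => (N : ℝ) * h N ^ (d + 2)) atTop atTop) :
    let betaN : ℕ → Ω → EuclideanSpace ℝ (Fin d) := fun N ω =>
      KernelGreeks.betaHat K ℓ φ x₀ N (h N) (fun i => Λ i ω) (fun i => Zs i ω)
    let V : EuclideanSpace ℝ (Fin d) → ℝ := fun x => ∫ ω, φ (Z x ω) ∂P
    let β : EuclideanSpace ℝ (Fin d) := gradient V x₀
    let cov : Matrix (Fin d) (Fin d) ℝ :=
      KernelGreeks.asymptoticCov K ℓ (∫ ω, φ (Z x₀ ω) ^ 2 ∂P)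
    let rate : ℕ → ℝ := fun N => Real.sqrt ((N : ℝ) * h N ^ (d + 2))
    ((∀ N, Integrable (betaN N) P) ∧
      TendstoInDistribution (fun N ω => rate N • (betaN N ω - ∫ ω', betaN N ω' ∂P)) atTop id
        (fun _ => P) (multivariateGaussian 0 cov)) ∧
    (KernelGreeks.DominatedOscillation p x₀ ℓ f φ →
      Tendsto (fun N : ℕ => (N : ℝ) * h N ^ (d + 2 + 2 * p)) atTop (𝓝 0) →
      DifferentiableAt ℝ V x₀ ∧
      Tendsto (fun N => (∫ ω, betaN N ω ∂P) - β) atTop (𝓝 0) ∧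
      Tendsto (fun N => rate N • ((∫ ω, betaN N ω ∂P) - β)) atTop (𝓝 0) ∧
      TendstoInDistribution (fun N ω => rate N • (betaN N ω - β)) atTop id
        (fun _ => P) (multivariateGaussian 0 cov)) := by
  obtain ⟨hnormal, hbias⟩ := theorem4p1_general P x₀ f hf_meas hf_nonneg
    (fun z => (KernelGreeks.IterDifferentiable.succ_iff.1 (hR1.differentiable_f z)).1.continuous)
    Z hZ ℓ (KernelGreeks.IterDifferentiable.contDiff_one hR1.differentiable_ℓ hK.order.1.ne')
    hℓ_nonneg hℓ_zero.ne' Λ Zs h_law h_indep φ hφ K hK.contDiff hK.compact h h_pos h_zero h_rate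
  exact ⟨hnormal, hbias p hK.order.1.ne' hR1.differentiable_ℓ hR1.differentiable_f
    hK.integral_eq_one hK.order.2.1⟩
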